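/- Let $\rho>0$, $0<\theta<2\pi$, $\nu=2\rho\sin\frac\theta2$ (so $\nu>0$), and $$q(x)=\rho\,\frac{1+e^{i\theta}e^{\nu x}}{1+e^{\nu x}},\qquad x\in\mathbb R .$$ Then $q$ is in the finite-density class: it is smooth, and $q-\rho$ as $x\to-\infty$, and $q-\rho e^{i\theta}$ as $x\to+\infty$, tend to $0$ together with all derivatives faster than any power of $|x|$. Let $c>0$ or $c=i\gamma$ with $\gamma>0$, and let $k\in\mathbb R$ and $\mu\in\mathbb R\setminus\{0\}$ satisfy $\mu^2=k^2-c^2\rho^2$ (either sign of $\mu$ is allowed). Put $$P=\begin{pmatrix}1&\frac{i(\mu-k)}{c\rho}\\-\frac{i(\mu-k)}{c\rho}&1\end{pmatrix},\quad E_-(x)=Pe^{-i\mu x\sigma_3},\quad E_+(x)=e^{i\frac\theta2\sigma_3}Pe^{-i\mu x\sigma_3},\quad \sigma_3=\begin{pmatrix}1&0\\0&-1\end{pmatrix},$$ $$\alpha=\frac{c\rho}{\mu}\sin\frac\theta2,\qquad \beta=\cos\frac\theta2+i\frac k\mu\sin\frac\theta2 .$$ There are unique Jost solutions $\Psi^\pm$,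 i.e. $2\times2$ matrix solutions on $\mathbb R$ of $$\Psi_x+ik\sigma_3\Psi=c\begin{pmatrix}0&q\\q^*&0\end{pmatrix}\Psi\qquad\text{with}\qquad\lim_{x\to\pm\infty}E_\pm(x)^{-1}\Psi^\pm(x)=I ,$$ and there is a unique matrix $S$ with $\Psi^+(x)=\Psi^-(x)S$ for all $x$; moreover $S=\lim_{x\to-\infty}E_-(x)^{-1}\Psi^+(x)$. It has the form $$S=\begin{pmatrix}a^*&b\\\frac{c^*}{c}b^*&a\end{pmatrix},$$ and its entries $a=a(k,c)$, $b=b(k,c)$ are $$a(k,c)=\frac{\left(\frac{2i\mu}\nu-c\right)\left(\frac{2i\mu}\nu+c\right)}{\beta\left(\frac{2i\mu}\nu\right)^2}\,\frac{\Gamma\left(1-\frac{2i\mu}\nu\right)^2}{\Gamma\left(1-\frac{2i\mu}\nu-c\right)\Gamma\left(1-\frac{2i\mu}\nu+c\right)}\qquad(\beta\ne0),$$ $$b(k,c)=\alpha\,\frac{\sin\pi c}{\pi c}\left(\frac{\sinh\frac{2\pi\mu}\nu}{\frac{2\pi\mu}\nu}\right)^{-1},$$ and $a(k,c)=0$ in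 the exceptional case $\beta=0$ (which occurs only for $c\in i\mathbb R$, $\theta=\pi$, $k=0$). If $c=n$ is a positive integer, then $\beta\neq0$ and the data are reflectionless multisoliton data: $$b(k,n)=0,\qquad a(k,n)=\frac1\beta\prod_{m=1}^n\frac{2\mu-im\nu}{2\mu+i(m-1)\nu}.$$ Finally, for every integer $n\ge 1$, consider the last expression at complex $(k,\mu)$ with $\mu^2=k^2-n^2\rho^2$, $\operatorname{Im}\mu>0$ and $\beta\ne0$ ($\beta$ being given by the same formula). There it vanishes if and only if $\mu=\frac{im\nu}2$ for some $m\in\{1,\dots,n\}$, and at every such zero $k$ is real with $|k|<n\rho$. -/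

import Mathlib

open Filter Topology ComplexConjugate

noncomputable section

/-- Finite density class: `q` is smooth and `q - ρ e^{i θ₋}`, `q - ρ e^{i θ₊}` are of Schwartz type
as `x → -∞`, `x → +∞` respectively. -/
def IsFiniteDensity (ρ θm θp : ℝ) (q : ℝ → ℂ) : Prop :=
  ContDiff ℝ ((⊤ : ℕ∞) : WithTop ℕ∞) q ∧
  ∀ m n : ℕ,
    Tendsto (fun x : ℝ => (x : ℂ) ^ m *
      iteratedDeriv n (fun y : ℝ => q y - ρ * Complex.exp (Complex.I * θm)) x) atBot (𝓝 0) ∧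
    Tendsto (fun x : ℝ => (x : ℂ) ^ m *
      iteratedDeriv n (fun y : ℝ => q y - ρ * Complex.exp (Complex.I * θp)) x) atTop (𝓝 0)

/-- The soliton initial data `ρ (1 + e^{iθ} e^{νx}) / (1 + e^{νx})`. -/
def solitonData (ρ θ ν : ℝ) (x : ℝ) : ℂ :=
  ρ * (1 + Complex.exp (Complex.I * θ) * Complex.exp (ν * x)) / (1 + Complex.exp (ν * x))

/-- The Pauli matrix `σ₃`. -/
def sigma3 : Matrix (Fin 2) (Fin 2) ℂ := !![1, 0; 0, -1]

/-- The matrix `e^{i z σ₃}`. -/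
def expSigma3 (z : ℂ) : Matrix (Fin 2) (Fin 2) ℂ :=
  !![Complex.exp (Complex.I * z), 0; 0, Complex.exp (-(Complex.I * z))]

/-- The off-diagonal matrix `c (0, u; u^*, 0)`; the potential is `W(x) = laxW c (q x)`. -/
def laxW (c u : ℂ) : Matrix (Fin 2) (Fin 2) ℂ := c • !![0, u; conj u, 0]

/-- The matrix `P_±` for the asymptotic value `ρ e^{iφ}` of the field. -/
def asymP (c : ℂ) (ρ φ k μ : ℝ) : Matrix (Fin 2) (Fin 2) ℂ :=
  expSigma3 (φ / 2) *
    !![1, Complex.I * (μ - k) / (c * ρ); -(Complex.I * (μ - k) / (c * ρ)), 1]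

/-- `E_±(x, k) = P_± e^{-i μ x σ₃}`. -/
def asymE (c : ℂ) (ρ φ k μ : ℝ) (x : ℝ) : Matrix (Fin 2) (Fin 2) ℂ :=
  asymP c ρ φ k μ * expSigma3 (-(μ * x))

/-- `P_±` diagonalizes `i k σ₃ - W_±` to `i μ σ₃`, where `W_±` is the potential at the
asymptotic value `ρ e^{iφ}`. -/
theorem asymP_diagonalizes (c : ℂ) (ρ φ k μ : ℝ) (hc : c ≠ 0) (hρ : ρ ≠ 0)
    (hμ : (μ : ℂ) ^ 2 = (k : ℂ) ^ 2 - c ^ 2 * (ρ : ℂ) ^ 2) :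
    ((Complex.I * k) • sigma3 - laxW c (ρ * Complex.exp (Complex.I * φ))) * asymP c ρ φ k μ =
      asymP c ρ φ k μ * ((Complex.I * μ) • sigma3) := by
  have hρ' : (ρ : ℂ) ≠ 0 := by exact_mod_cast hρ
  have hI : Complex.I ^ 2 = -1 := Complex.I_sq
  have h1 : Complex.exp (Complex.I * φ) =
      Complex.exp (Complex.I * (φ / 2)) ^ 2 := by
    rw [← Complex.exp_nat_mul]; congr 1; push_cast; ring
  have h2 : Complex.exp (-(Complex.I * φ)) =
      Complex.exp (-(Complex.I * (φ / 2))) ^ 2 := by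
    rw [← Complex.exp_nat_mul]; congr 1; push_cast; ring
  have h3 : Complex.exp (Complex.I * (φ / 2)) * Complex.exp (-(Complex.I * (φ / 2))) = 1 := by
    rw [← Complex.exp_add]; simp
  have h4 : conj (Complex.exp (Complex.I * φ)) = Complex.exp (-(Complex.I * φ)) := by
    rw [← Complex.exp_conj]; simp
  ext i j
  fin_cases i <;> fin_cases j <;>
    simp [sigma3, laxW, asymP, expSigma3, Matrix.mul_apply, Fin.sum_univ_two, h4, h1, h2] <;>
    generalize Complex.exp (Complex.I * (φ / 2)) = e at * <;>
    generalize Complex.exp (-(Complex.I * (φ / 2))) = f at * <;>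
    field_simp <;> grind

/-- `Ψ` solves `Ψ_x + i k σ₃ Ψ = W Ψ` on the line and `E(x, k)⁻¹ Ψ(x) → 1` along `l`
(`l = atTop` for `Ψ⁺`, `l = atBot` for `Ψ⁻`), `φ` being the phase of the field at that end. -/
def IsJost (l : Filter ℝ) (q : ℝ → ℂ) (c : ℂ) (ρ φ k μ : ℝ)
    (Ψ : ℝ → Matrix (Fin 2) (Fin 2) ℂ) : Prop :=
  (∀ x i j, HasDerivAt (fun y => Ψ y i j)
    (((-(Complex.I * k)) • sigma3 * Ψ x + laxW c (q x) * Ψ x) i j) x) ∧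
  Tendsto (fun x => (asymE c ρ φ k μ x)⁻¹ * Ψ x) l (𝓝 1)

/-- `S` is a scattering matrix of `q`: it connects Jost solutions by `Ψ⁺ = Ψ⁻ S`. -/
def IsScatteringMatrix (q : ℝ → ℂ) (c : ℂ) (ρ θm θp k μ : ℝ)
    (S : Matrix (Fin 2) (Fin 2) ℂ) : Prop :=
  ∃ Ψp Ψm : ℝ → Matrix (Fin 2) (Fin 2) ℂ,
    IsJost atTop q c ρ θp k μ Ψp ∧ IsJost atBot q c ρ θm k μ Ψm ∧ ∀ x, Ψp x = Ψm x * S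

/-- `α = (c ρ / μ) sin (θ/2)`. -/
def scatAlpha (c : ℂ) (ρ θ : ℝ) (μ : ℂ) : ℂ := c * ρ / μ * Real.sin (θ / 2)

/-- `β = cos (θ/2) + i (k / μ) sin (θ/2)`. -/
def scatBeta (θ : ℝ) (k μ : ℂ) : ℂ :=
  Real.cos (θ / 2) + Complex.I * (k / μ) * Real.sin (θ / 2)

/-- `β⁻¹ ∏_{m=1}^n (2μ - i m ν) / (2μ + i (m-1) ν)`. -/
def multisolitonA (n : ℕ) (θ ν : ℝ) (k μ : ℂ) : ℂ :=
  1 / scatBeta θ k μ * ∏ m ∈ Finset.Icc 1 n,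
    (2 * μ - Complex.I * m * ν) / (2 * μ + Complex.I * ((m : ℂ) - 1) * ν)

end

/-! In the variable `w = 1 / (1 + e^{νx})` the potential is affine and `w' = -ν w (1 - w)`, so the
Lax system has singular points `0, 1, ∞` and is solved by hypergeometric functions. Put `t = 2iμ/ν`,
`p = i(μ - k)/(cρ)`, `H = ₂F₁(c, -c; 1 - t; w)` and `G = w dH/dw`. The second column of `Ψ⁺` is
`e^{iμx} (H e^{iθσ₃/2} (p, 1)ᵀ - (i/c) G (1, -p)ᵀ)` (`isLaxColumn_jost`). Its first column follows
from a conjugation symmetry, as `c²` is real.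

At `x → +∞`, that is `w → 0`, one has `H → 1` and `G → 0`. At `x → -∞`, that is `w → 1⁻`, the
coordinates of the column in the basis `E₋` are exactly `-i/(ct) e^{2iμx} (tG - c²H)` and `β(-k) H`.
Gauss's summation theorem (`tsum_gaussCoeff`) gives the limit of `H`, hence `a`. Since `t` is
imaginary, `G` oscillates without decay; `(1 - w)^t (tG - c²H)` converges because the coefficients
of `dG/dw` are asymptotic to a multiple of those of `(1 - w)^{-(1+t)}`. The constant is a quotient
of Euler sine products and gives `b` (`tendsto_cpow_mul_gaussG_sub`).

Wronskians are constant, so the limit of `E₋⁻¹ Ψ⁺` yields existence of `Ψ⁻`, uniqueness of both Jost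
solutions and the matrix `S` (`scattering_of_tendsto`). The stated form of `a` uses `β(k) β(-k) = 1
+ α² = (t² - c²)/t²`; for `c = n` the Gamma quotient collapses to a finite product. -/

noncomputable section

/-! ### Power series with bounded coefficients -/

/-- The sum `∑ aₙ zⁿ`. -/
def powerSum (a : ℕ → ℂ) (z : ℂ) : ℂ := ∑' n, a n * z ^ n

theorem summable_powerSum {a : ℕ → ℂ} {M : ℝ} (ha : ∀ n, ‖a n‖ ≤ M) {z : ℂ} (hz : ‖z‖ < 1) :
    Summable fun n => a n * z ^ n := by
  refine Summable.of_norm_bounded ((summable_geometric_of_lt_one (norm_nonneg z) hz).mul_left M) ?_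
  intro n
  rw [norm_mul, norm_pow]
  gcongr
  exact ha n

theorem powerSum_eq_zero_add {a : ℕ → ℂ} {M : ℝ} (ha : ∀ n, ‖a n‖ ≤ M) {z : ℂ} (hz : ‖z‖ < 1) :
    powerSum a z = a 0 + z * powerSum (fun n => a (n + 1)) z := by
  rw [powerSum, (summable_powerSum ha hz).tsum_eq_zero_add, powerSum, ← tsum_mul_left]
  simp only [pow_zero, mul_one]
  congr 1
  exact tsum_congr fun n => by ring

/-- Termwise differentiation on a ball of radius `r` strictly between `‖z‖` and `1`, where the
derivatives are dominated by a geometric series. -/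
theorem hasDerivAt_powerSum {a : ℕ → ℂ} {M : ℝ} (ha : ∀ n : ℕ, ‖((n : ℂ) + 1) * a (n + 1)‖ ≤ M)
    {z : ℂ} (hz : ‖z‖ < 1) :
    HasDerivAt (powerSum a) (powerSum (fun n : ℕ => ((n : ℂ) + 1) * a (n + 1)) z) z := by
  obtain ⟨r, hr, hr1⟩ := exists_between hz
  have hr0 : 0 < r := (norm_nonneg z).trans_lt hr
  have hM : 0 ≤ M := (norm_nonneg _).trans (ha 0)
  have key : HasDerivAt (fun y => ∑' n : ℕ, a n * y ^ n)
      (∑' n : ℕ, a n * (n * z ^ (n - 1))) z := by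
    -- At `n = 0` truncated subtraction makes the bound `M`; the term itself is zero there.
    refine hasDerivAt_tsum_of_isPreconnected (u := fun n => M * r ^ (n - 1))
      (g := fun n y => a n * y ^ n) (g' := fun n y => a n * (n * y ^ (n - 1)))
      (t := Metric.ball (0 : ℂ) r) (y₀ := 0) ?_ Metric.isOpen_ball
      (convex_ball _ _).isPreconnected ?_ ?_ (by simpa using hr0) ?_ (by simpa using hr)
    · refine Summable.mul_left _ ?_
      rw [← summable_nat_add_iff 1]
      simpa using summable_geometric_of_lt_one hr0.le hr1
    · intro n y _
      exact (hasDerivAt_pow n y).const_mul (a n)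
    · intro n y hy
      rcases n with _ | n
      · simpa using hM
      · have hy' : ‖y‖ ≤ r := by simpa using (Metric.mem_ball.1 hy).le
        have e : a (n + 1) * (((n + 1 : ℕ) : ℂ) * y ^ (n + 1 - 1)) =
            (((n : ℂ) + 1) * a (n + 1)) * y ^ n := by
          simp only [Nat.add_sub_cancel]; push_cast; ring
        rw [e, norm_mul, norm_pow, Nat.add_sub_cancel]
        gcongr
        exact ha n
    · refine summable_of_ne_finset_zero (s := {0}) ?_
      intro n hn
      simp [show n ≠ 0 by simpa using hn]
  have e : ∑' n : ℕ, a n * (n * z ^ (n - 1)) = powerSum (fun n : ℕ => ((n : ℂ) + 1) * a (n + 1)) z := by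
    have hs : Summable fun n : ℕ => a n * (n * z ^ (n - 1)) := by
      rw [← summable_nat_add_iff 1]
      refine (summable_powerSum ha hz).congr fun n => ?_
      simp only [Nat.add_sub_cancel]; push_cast; ring
    rw [hs.tsum_eq_zero_add, powerSum]
    simp only [Nat.cast_zero, zero_mul, mul_zero, zero_add]
    exact tsum_congr fun n => by simp only [Nat.add_sub_cancel]; push_cast; ring
  rw [← e]
  exact key

/-- If `aₙ → 0` then `∑ aₙ xⁿ = o(1 / (1 - x))` as `x → 1⁻`. -/
theorem tendsto_one_sub_mul_powerSum {a : ℕ → ℂ} (ha : Tendsto a atTop (𝓝 0)) :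
    Tendsto (fun x : ℝ => (1 - x) * ‖powerSum a x‖) (𝓝[<] 1) (𝓝 0) := by
  obtain ⟨M, hM⟩ : ∃ M, ∀ n, ‖a n‖ ≤ M := by
    obtain ⟨M, hM⟩ := (Metric.isBounded_range_of_tendsto a ha).exists_norm_le
    exact ⟨M, fun n => hM _ ⟨n, rfl⟩⟩
  have hM0 : 0 ≤ M := (norm_nonneg _).trans (hM 0)
  rw [Metric.tendsto_nhds]
  intro e he
  obtain ⟨N, hN⟩ := Filter.eventually_atTop.1 ((Metric.tendsto_nhds.1 ha) (e / 2) (by positivity))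
  have hN' : ∀ n, N ≤ n → ‖a n‖ ≤ e / 2 := fun n hn => by
    simpa [dist_zero_right] using (hN n hn).le
  have hlim : Tendsto (fun x : ℝ => (1 - x) * (N * M)) (𝓝[<] 1) (𝓝 0) := by
    have : Tendsto (fun x : ℝ => (1 - x) * (N * M)) (𝓝 1) (𝓝 ((1 - 1) * (N * M))) :=
      Continuous.tendsto (by fun_prop) 1
    simpa using this.mono_left nhdsWithin_le_nhds
  filter_upwards [(Metric.tendsto_nhds.1 hlim) (e / 2) (by positivity), self_mem_nhdsWithin,
    mem_nhdsWithin_of_mem_nhds (lt_mem_nhds (zero_lt_one' ℝ))] with x hx hx1 hx0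
  have hx1 : x < 1 := hx1
  have hxn : ‖(x : ℂ)‖ < 1 := by rw [Complex.norm_real, Real.norm_of_nonneg hx0.le]; exact hx1
  have hg := (hasSum_geometric_of_lt_one hx0.le hx1).mul_left (e / 2)
  have hf : HasSum (fun n => if n < N then M else 0) (N * M) := by
    have h1 : HasSum (fun n => if n < N then M else 0)
        (∑ n ∈ Finset.range N, if n < N then M else 0) :=
      hasSum_sum_of_ne_finset_zero fun n hn => if_neg (by simpa using hn)
    have h2 : (∑ n ∈ Finset.range N, if n < N then M else 0) = N * M := by
      rw [Finset.sum_congr rfl fun n hn => if_pos (Finset.mem_range.1 hn)]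
      simp
    rwa [h2] at h1
  -- The first `N` terms cost at most `M` each; the tail is at most `e / 2` times the geometric
  -- series.
  have hbd : ‖powerSum a x‖ ≤ N * M + e / 2 * (1 - x)⁻¹ := by
    refine tsum_of_norm_bounded (hf.add hg) fun n => ?_
    rw [norm_mul, norm_pow, Complex.norm_real, Real.norm_of_nonneg hx0.le]
    split_ifs with h
    · have h1 : ‖a n‖ * x ^ n ≤ M * 1 :=
        mul_le_mul (hM n) (pow_le_one₀ hx0.le hx1.le) (by positivity) hM0
      have h2 : 0 ≤ e / 2 * x ^ n := by positivity
      linarith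
    · rw [zero_add]
      gcongr
      exact hN' n (not_lt.1 h)
  have h1x : 0 < 1 - x := by linarith
  rw [dist_zero_right, Real.norm_of_nonneg (by positivity)] at hx ⊢
  calc (1 - x) * ‖powerSum a x‖ ≤ (1 - x) * (N * M + e / 2 * (1 - x)⁻¹) := by gcongr
    _ = (1 - x) * (N * M) + e / 2 := by field_simp
    _ < e := by linarith

/-! ### Binomial coefficients with purely imaginary shift -/

/-- The partial products of Euler's product for `sin (π z) / (π z)`. -/
def eulerSinProd (z : ℂ) (n : ℕ) : ℂ :=
  ∏ j ∈ Finset.range n, ((1 : ℂ) - z ^ 2 / ((j : ℂ) + 1) ^ 2)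

theorem tendsto_eulerSinProd {z : ℂ} (hz : z ≠ 0) :
    Tendsto (eulerSinProd z) atTop (𝓝 (Complex.sin (Real.pi * z) / (Real.pi * z))) := by
  have hpi : (Real.pi : ℂ) * z ≠ 0 := mul_ne_zero (by exact_mod_cast Real.pi_ne_zero) hz
  refine ((Complex.tendsto_euler_sin_prod z).div_const (Real.pi * z)).congr fun n => ?_
  rw [eulerSinProd]; field_simp

theorem exists_norm_eulerSinProd_le {z : ℂ} (hz : z ≠ 0) : ∃ M, ∀ n, ‖eulerSinProd z n‖ ≤ M := by
  obtain ⟨M, hM⟩ := (Metric.isBounded_range_of_tendsto _ (tendsto_eulerSinProd hz)).exists_norm_le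
  exact ⟨M, fun n => hM _ ⟨n, rfl⟩⟩

/-- The Taylor coefficients `(1 + t)ₙ / n!` of `(1 - x) ^ (-(1 + t))`. -/
def binomCoeff (t : ℂ) (n : ℕ) : ℂ := ∏ j ∈ Finset.range n, (1 + t / ((j : ℂ) + 1))

theorem conj_eq_neg_of_re_eq_zero {t : ℂ} (ht : t.re = 0) : conj t = -t := by
  apply Complex.ext <;> simp [ht]

/-- For imaginary `t` conjugation replaces `t` by `-t`, so the squared modulus is a partial Euler
product, which converges. -/
theorem exists_norm_binomCoeff_le {t : ℂ} (ht : t.re = 0) (ht0 : t ≠ 0) :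
    ∃ M, ∀ n, ‖binomCoeff t n‖ ≤ M := by
  obtain ⟨M, hM⟩ := exists_norm_eulerSinProd_le ht0
  refine ⟨1 + M, fun n => ?_⟩
  have h : binomCoeff t n * conj (binomCoeff t n) = eulerSinProd t n := by
    rw [binomCoeff, map_prod, ← Finset.prod_mul_distrib, eulerSinProd]
    refine Finset.prod_congr rfl fun j _ => ?_
    have hj : (j : ℂ) + 1 ≠ 0 := by exact_mod_cast Nat.succ_ne_zero j
    simp only [map_add, map_div₀, map_one, Complex.conj_natCast, conj_eq_neg_of_re_eq_zero ht]
    field_simp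
    ring
  have h2 : ‖binomCoeff t n‖ ^ 2 ≤ M := by
    rw [sq]
    calc ‖binomCoeff t n‖ * ‖binomCoeff t n‖ = ‖binomCoeff t n * conj (binomCoeff t n)‖ := by
          rw [norm_mul, RCLike.norm_conj]
      _ ≤ M := by rw [h]; exact hM n
  nlinarith [sq_nonneg (‖binomCoeff t n‖ - 1), norm_nonneg (binomCoeff t n)]

/-- Both sides are the rising factorial `(1 + t)ₙ` over `n!`; the right-hand form is the one in the
binomial series. -/
theorem binomCoeff_eq_choose (t : ℂ) (n : ℕ) :
    binomCoeff t n = Ring.choose (1 + t + n - 1) n := by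
  have h : ∀ m : ℕ, (ascPochhammer ℂ m).eval (1 + t) = m.factorial * binomCoeff t m := by
    intro m
    induction m with
    | zero => simp [binomCoeff]
    | succ m ih =>
      have hm : (m : ℂ) + 1 ≠ 0 := by exact_mod_cast Nat.succ_ne_zero m
      rw [ascPochhammer_succ_eval, ih, binomCoeff, binomCoeff, Finset.prod_range_succ,
        Nat.factorial_succ]
      push_cast
      field_simp
      ring
  have hn : (n.factorial : ℂ) ≠ 0 := by exact_mod_cast n.factorial_ne_zero
  rw [Ring.choose_eq_smul, Polynomial.descPochhammer_smeval_eq_ascPochhammer,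
    Polynomial.ascPochhammer_smeval_eq_eval,
    show 1 + t + (n : ℂ) - 1 - n + 1 = 1 + t by ring, h, smul_eq_mul]
  field_simp

theorem powerSum_binomCoeff (t : ℂ) {x : ℝ} (hx0 : 0 ≤ x) (hx1 : x < 1) :
    ((1 - x : ℝ) : ℂ) ^ (1 + t) * powerSum (binomCoeff t) x = 1 := by
  have hx : (x : ℂ) ∈ Metric.eball (0 : ℂ) 1 := by
    rw [← ENNReal.coe_one, Metric.eball_coe, NNReal.coe_one, mem_ball_zero_iff, Complex.norm_real,
      Real.norm_of_nonneg hx0]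
    exact hx1
  have h := ((Complex.one_div_one_sub_cpow_hasFPowerSeriesOnBall_zero (1 + t)).hasSum hx).tsum_eq
  simp only [FormalMultilinearSeries.ofScalars_apply_eq, smul_eq_mul, zero_add,
    ← binomCoeff_eq_choose] at h
  have h1 : ((1 - x : ℝ) : ℂ) ^ (1 + t) ≠ 0 := by
    have : ((1 - x : ℝ) : ℂ) ≠ 0 := by exact_mod_cast (sub_pos.2 hx1).ne'
    exact fun h => this ((Complex.cpow_eq_zero_iff _ _).1 h).1
  rw [powerSum, h]
  push_cast at h1 ⊢
  field_simp

/-! ### The hypergeometric function `₂F₁(c, -c; C; ·)` -/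

/-- The Taylor coefficients of `₂F₁(c, -c; C; ·)`. -/
def gaussCoeff (c C : ℂ) (n : ℕ) : ℂ :=
  ∏ j ∈ Finset.range n, ((j : ℂ) ^ 2 - c ^ 2) / ((C + j) * ((j : ℂ) + 1))

theorem natCast_add_one_ne_zero (n : ℕ) : (n : ℂ) + 1 ≠ 0 := by exact_mod_cast n.succ_ne_zero

theorem add_natCast_ne_zero {C : ℂ} (hC : 1 ≤ C.re) (n : ℕ) : C + n ≠ 0 := by
  intro h
  have := congrArg Complex.re h
  simp only [Complex.add_re, Complex.natCast_re, Complex.zero_re] at this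
  have : (0 : ℝ) ≤ n := n.cast_nonneg
  linarith

theorem gaussCoeff_succ (c C : ℂ) (n : ℕ) : gaussCoeff c C (n + 1) =
    gaussCoeff c C n * (((n : ℂ) ^ 2 - c ^ 2) / ((C + n) * ((n : ℂ) + 1))) :=
  Finset.prod_range_succ _ _

theorem eulerSinProd_succ (z : ℂ) (n : ℕ) : eulerSinProd z (n + 1) =
    eulerSinProd z n * (1 - z ^ 2 / ((n : ℂ) + 1) ^ 2) :=
  Finset.prod_range_succ _ _

theorem binomCoeff_succ (t : ℂ) (n : ℕ) : binomCoeff t (n + 1) =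
    binomCoeff t n * (1 + t / ((n : ℂ) + 1)) :=
  Finset.prod_range_succ _ _

theorem binomCoeff_ne_zero {t : ℂ} (ht : t.re = 0) (n : ℕ) : binomCoeff t n ≠ 0 := by
  refine Finset.prod_ne_zero_iff.2 fun j _ h => ?_
  have hj := natCast_add_one_ne_zero j
  have h1 : (j : ℂ) + 1 + t = 0 := by
    field_simp at h; simpa using h
  have := congrArg Complex.re h1
  simp only [Complex.add_re, Complex.natCast_re, Complex.zero_re, Complex.one_re, ht] at this
  have : (0 : ℝ) ≤ j := j.cast_nonneg
  linarith

theorem binomCoeff_mul_neg (t : ℂ) (n : ℕ) :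
    binomCoeff t n * binomCoeff (-t) n = eulerSinProd t n := by
  rw [binomCoeff, binomCoeff, ← Finset.prod_mul_distrib, eulerSinProd]
  refine Finset.prod_congr rfl fun j _ => ?_
  have := natCast_add_one_ne_zero j
  field_simp
  ring

/-- The factor `binomCoeff (-t) (n + 1) = (1 - t)ₙ₊₁ / (n + 1)!` cancels the parameter `1 - t`. The
factor `j = 0` of what remains is `-c²`, the others form the Euler product. -/
theorem gaussCoeff_mul_binomCoeff {c t : ℂ} (ht : t.re = 0) (n : ℕ) :
    ((n : ℂ) + 1) ^ 2 * gaussCoeff c (1 - t) (n + 1) * binomCoeff (-t) (n + 1) =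
      -c ^ 2 * eulerSinProd c n := by
  have hC : ∀ m : ℕ, 1 - t + m ≠ 0 := add_natCast_ne_zero (by simp [ht])
  induction n with
  | zero =>
    have h0 : 1 - t ≠ 0 := by simpa using hC 0
    simp [gaussCoeff, binomCoeff, eulerSinProd]
    field_simp
    ring
  | succ n ih =>
    have h1 := hC (n + 1)
    have h2 := natCast_add_one_ne_zero n
    have h3 := natCast_add_one_ne_zero (n + 1)
    rw [gaussCoeff_succ, binomCoeff_succ _ (n + 1), eulerSinProd_succ]
    calc _ = ((n : ℂ) + 1) ^ 2 * gaussCoeff c (1 - t) (n + 1) * binomCoeff (-t) (n + 1) *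
          ((((n + 1 : ℕ) : ℂ) ^ 2 - c ^ 2) / ((n : ℂ) + 1) ^ 2) := by
          push_cast at h1 h3 ⊢
          field_simp
          ring
      _ = _ := by
          rw [ih]
          push_cast
          field_simp

/-- `Re C ≥ 1` gives `|C + j| ≥ 1 + j`, so `C = 1` is the worst case. -/
theorem norm_gaussCoeff_le {c C : ℂ} (hC : 1 ≤ C.re) (n : ℕ) :
    ‖gaussCoeff c C n‖ ≤ ‖gaussCoeff c 1 n‖ := by
  rw [gaussCoeff, gaussCoeff, norm_prod, norm_prod]
  refine Finset.prod_le_prod (fun _ _ => norm_nonneg _) fun j _ => ?_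
  have h : ‖(1 : ℂ) + j‖ ≤ ‖C + j‖ := by
    have h1 : ‖(1 : ℂ) + j‖ = 1 + j := by
      rw [show (1 : ℂ) + j = ((1 + j : ℝ) : ℂ) by push_cast; rfl, Complex.norm_real,
        Real.norm_of_nonneg (by positivity)]
    rw [h1]
    refine le_trans ?_ ((le_abs_self _).trans (Complex.abs_re_le_norm _))
    simpa using hC
  have h0 : 0 < ‖(1 : ℂ) + j‖ := norm_pos_iff.2 (add_natCast_ne_zero (by simp) j)
  have h1 : 0 < ‖(j : ℂ) + 1‖ := norm_pos_iff.2 (natCast_add_one_ne_zero j)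
  rw [norm_div, norm_div, norm_mul, norm_mul]
  gcongr

/-- The case `C = 1` is the preceding identity at `t = 0`. The decay `O(1/n²)`, uniform in `C`,
gives convergence at `1` and bounded coefficients for `G'`. -/
theorem exists_norm_sq_mul_gaussCoeff_le {c : ℂ} (hc : c ≠ 0) :
    ∃ M, ∀ C : ℂ, 1 ≤ C.re → ∀ n : ℕ, ‖((n : ℂ) + 1) ^ 2 * gaussCoeff c C (n + 1)‖ ≤ M := by
  obtain ⟨M, hM⟩ := exists_norm_eulerSinProd_le hc
  refine ⟨‖c ^ 2‖ * M, fun C hC n => ?_⟩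
  have h := gaussCoeff_mul_binomCoeff (c := c) (t := 0) (by simp) n
  have h0 : binomCoeff 0 (n + 1) = 1 := by simp [binomCoeff]
  rw [sub_zero, neg_zero, h0, mul_one] at h
  calc _ ≤ ‖((n : ℂ) + 1) ^ 2 * gaussCoeff c 1 (n + 1)‖ := by
        rw [norm_mul, norm_mul]
        gcongr
        exact norm_gaussCoeff_le hC _
    _ ≤ _ := by
        rw [h, norm_mul, norm_neg]
        gcongr
        exact hM n

theorem norm_natCast_add_one (n : ℕ) : ‖(n : ℂ) + 1‖ = n + 1 := by
  rw [show (n : ℂ) + 1 = ((n + 1 : ℕ) : ℂ) by push_cast; rfl, Complex.norm_natCast]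
  push_cast; rfl

theorem summable_norm_gaussCoeff {c C : ℂ} (hc : c ≠ 0) (hC : 1 ≤ C.re) :
    Summable fun n => ‖gaussCoeff c C n‖ := by
  obtain ⟨M, hM⟩ := exists_norm_sq_mul_gaussCoeff_le hc
  rw [← summable_nat_add_iff 1]
  have hs : Summable fun n : ℕ => 1 / ((n : ℝ) + 1) ^ 2 := by
    have := (summable_nat_add_iff 1).2 (Real.summable_one_div_nat_pow.2 one_lt_two)
    simpa using this
  refine Summable.of_nonneg_of_le (fun _ => norm_nonneg _) (fun n => ?_) (hs.mul_left M)
  have h := hM C hC n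
  rw [norm_mul, norm_pow, norm_natCast_add_one] at h
  rw [mul_one_div, le_div_iff₀ (by positivity), mul_comm]
  exact h

theorem tendsto_natCast_mul_gaussCoeff {c C : ℂ} (hc : c ≠ 0) (hC : 1 ≤ C.re) :
    Tendsto (fun n : ℕ => (n : ℂ) * gaussCoeff c C n) atTop (𝓝 0) := by
  obtain ⟨M, hM⟩ := exists_norm_sq_mul_gaussCoeff_le hc
  rw [← tendsto_add_atTop_iff_nat 1]
  refine squeeze_zero_norm (a := fun n : ℕ => M * (1 / ((n : ℝ) + 1))) (fun n => ?_) ?_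
  · have h := hM C hC n
    rw [norm_mul, norm_pow, norm_natCast_add_one] at h
    push_cast
    rw [norm_mul, norm_natCast_add_one, mul_one_div, le_div_iff₀ (by positivity)]
    nlinarith
  · simpa using tendsto_one_div_add_atTop_nhds_zero_nat.const_mul M

theorem gaussCoeff_add_one {c C : ℂ} (hC : 1 ≤ C.re) (n : ℕ) :
    gaussCoeff c (C + 1) n * (C + n) = C * gaussCoeff c C n := by
  induction n with
  | zero => simp [gaussCoeff]
  | succ n ih =>
    have h1 := add_natCast_ne_zero hC n
    have h2 : C + 1 + n ≠ 0 := by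
      have := add_natCast_ne_zero hC (n + 1)
      push_cast at this
      rwa [add_right_comm, add_assoc]
    have h3 := natCast_add_one_ne_zero n
    rw [gaussCoeff_succ, gaussCoeff_succ, ← mul_assoc, ← ih]
    push_cast
    field_simp
    ring

/-- The difference of the two series telescopes, with partial sums `-C N gaussCoeff c C N → 0`. -/
theorem tsum_gaussCoeff_contiguous {c C : ℂ} (hc : c ≠ 0) (hC : 1 ≤ C.re) :
    C ^ 2 * ∑' n, gaussCoeff c C n = (C ^ 2 - c ^ 2) * ∑' n, gaussCoeff c (C + 1) n := by
  have hC1 : 1 ≤ (C + 1).re := by simp; linarith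
  have h1 := (summable_norm_gaussCoeff hc hC).of_norm.hasSum.mul_left (C ^ 2)
  have h2 := (summable_norm_gaussCoeff hc hC1).of_norm.hasSum.mul_left (C ^ 2 - c ^ 2)
  have h3 := (h1.sub h2).tendsto_sum_nat
  have h4 : Tendsto (fun N : ℕ => ∑ n ∈ Finset.range N,
      (C ^ 2 * gaussCoeff c C n - (C ^ 2 - c ^ 2) * gaussCoeff c (C + 1) n)) atTop (𝓝 0) := by
    have h5 := (tendsto_natCast_mul_gaussCoeff hc hC).const_mul (-C)
    rw [mul_zero] at h5
    refine h5.congr fun N => ?_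
    have h6 : ∀ n : ℕ, C ^ 2 * gaussCoeff c C n - (C ^ 2 - c ^ 2) * gaussCoeff c (C + 1) n =
        -C * (((n + 1 : ℕ) : ℂ) * gaussCoeff c C (n + 1)) - -C * ((n : ℂ) * gaussCoeff c C n) := by
      intro n
      have h7 := add_natCast_ne_zero hC n
      have h8 := natCast_add_one_ne_zero n
      have h9 : gaussCoeff c (C + 1) n = C * gaussCoeff c C n / (C + n) := by
        rw [eq_div_iff h7, gaussCoeff_add_one hC]
      rw [gaussCoeff_succ, h9]
      push_cast
      field_simp
      ring
    simp_rw [h6]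
    rw [Finset.sum_range_sub fun n : ℕ => -C * ((n : ℂ) * gaussCoeff c C n)]
    simp
  exact sub_eq_zero.1 (tendsto_nhds_unique h3 h4)

theorem tsum_gaussCoeff_eq_prod_mul {c C : ℂ} (hc : c ≠ 0) (hC : 1 ≤ C.re) (N : ℕ) :
    ∑' n, gaussCoeff c C n = (∏ j ∈ Finset.range N, ((C + j) ^ 2 - c ^ 2) / (C + j) ^ 2) *
      ∑' n, gaussCoeff c (C + N) n := by
  induction N with
  | zero => simp
  | succ N ih =>
    have hN : 1 ≤ (C + N).re := by
      have : (0 : ℝ) ≤ N := N.cast_nonneg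
      simp; linarith
    have h := tsum_gaussCoeff_contiguous hc hN
    have h0 := add_natCast_ne_zero hC N
    rw [ih, Finset.prod_range_succ]
    push_cast
    rw [← add_assoc, mul_assoc, div_mul_eq_mul_div, ← h]
    field_simp

/-- Every coefficient but the zeroth tends to `0`; the coefficients at `C = 1` dominate. -/
theorem tendsto_tsum_gaussCoeff {c C : ℂ} (hc : c ≠ 0) (hC : 1 ≤ C.re) :
    Tendsto (fun N : ℕ => ∑' n, gaussCoeff c (C + N) n) atTop (𝓝 1) := by
  have h1 : ∑' n, (0 : ℂ) ^ n = 1 := by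
    rw [tsum_eq_single 0 fun n hn => zero_pow hn, pow_zero]
  rw [← h1]
  refine tendsto_tsum_of_dominated_convergence
    (summable_norm_gaussCoeff (C := 1) hc (by simp)) (fun n => ?_) (Eventually.of_forall fun N n => ?_)
  · have : (0 : ℂ) ^ n = ∏ j ∈ Finset.range n, 0 := by simp
    rw [this]
    refine tendsto_finsetProd _ fun j _ => ?_
    have h2 : Tendsto (fun N : ℕ => ‖C + N + j‖) atTop atTop := by
      refine tendsto_atTop_mono (f := fun N : ℕ => (N : ℝ)) (fun N => ?_)
        tendsto_natCast_atTop_atTop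
      refine le_trans ?_ ((le_abs_self _).trans (Complex.abs_re_le_norm _))
      have : (0 : ℝ) ≤ j := j.cast_nonneg
      simp
      linarith
    have h3 : Tendsto (fun N : ℕ => (C + N + j)⁻¹) atTop (𝓝 0) := by
      rw [tendsto_zero_iff_norm_tendsto_zero]
      simp only [norm_inv]
      exact tendsto_inv_atTop_zero.comp h2
    have h4 := h3.const_mul (((j : ℂ) ^ 2 - c ^ 2) / ((j : ℂ) + 1))
    rw [mul_zero] at h4
    refine h4.congr fun N => ?_
    rw [div_mul_eq_mul_div, ← div_eq_mul_inv, div_div]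
  · refine norm_gaussCoeff_le ?_ n
    have : (0 : ℝ) ≤ N := N.cast_nonneg
    simp; linarith

/-- Gauss's summation theorem for `₂F₁(c, -c; C; 1)`. -/
theorem tsum_gaussCoeff {c C : ℂ} (hc : c ≠ 0) (hC : 1 ≤ C.re) (h1 : Complex.Gamma (C - c) ≠ 0)
    (h2 : Complex.Gamma (C + c) ≠ 0) : ∑' n, gaussCoeff c C n =
      Complex.Gamma C ^ 2 / (Complex.Gamma (C - c) * Complex.Gamma (C + c)) := by
  -- Iterating the contiguous relation produces exactly the quotient of Euler's sequences for `Γ`;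
  -- the powers of `N` and the factorials cancel.
  have hlim := (((Complex.GammaSeq_tendsto_Gamma C).pow 2).div
    ((Complex.GammaSeq_tendsto_Gamma (C - c)).mul (Complex.GammaSeq_tendsto_Gamma (C + c)))
    (mul_ne_zero h1 h2)).mul ((tendsto_tsum_gaussCoeff hc hC).comp (tendsto_add_atTop_nat 1))
  rw [mul_one] at hlim
  refine tendsto_nhds_unique (tendsto_const_nhds.congr' ?_) hlim
  filter_upwards [eventually_ge_atTop 1] with N hN
  have hN0 : (N : ℂ) ≠ 0 := by exact_mod_cast (by omega : N ≠ 0)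
  have hf : (N.factorial : ℂ) ≠ 0 := by exact_mod_cast N.factorial_ne_zero
  have e1 : (N : ℂ) ^ (C - c) * (N : ℂ) ^ (C + c) = ((N : ℂ) ^ C) ^ 2 := by
    rw [← Complex.cpow_add _ _ hN0, sq, ← Complex.cpow_add _ _ hN0]; congr 1; ring
  have hp : (N : ℂ) ^ C ≠ 0 := fun h => hN0 ((Complex.cpow_eq_zero_iff _ _).1 h).1
  have hprod : ∏ j ∈ Finset.range (N + 1), (C + j) ≠ 0 :=
    Finset.prod_ne_zero_iff.2 fun j _ => add_natCast_ne_zero hC j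
  have e2 : ∏ j ∈ Finset.range (N + 1), ((C + j) ^ 2 - c ^ 2) / (C + j) ^ 2 =
      (∏ j ∈ Finset.range (N + 1), (C - c + j)) * (∏ j ∈ Finset.range (N + 1), (C + c + j)) /
        (∏ j ∈ Finset.range (N + 1), (C + j)) ^ 2 := by
    rw [← Finset.prod_mul_distrib, ← Finset.prod_pow, ← Finset.prod_div_distrib]
    refine Finset.prod_congr rfl fun j _ => ?_
    congr 1
    ring
  rw [tsum_gaussCoeff_eq_prod_mul hc hC (N + 1), e2]
  simp only [Function.comp_apply, Pi.div_apply]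
  congr 1
  simp only [Complex.GammaSeq]
  rw [div_mul_div_comm, div_pow, div_div_div_eq, mul_mul_mul_comm ((N : ℂ) ^ (C - c)), e1]
  field_simp

/-- `H = ₂F₁(c, -c; 1 - t; ·)`. -/
def gaussH (c t z : ℂ) : ℂ := powerSum (gaussCoeff c (1 - t)) z

/-- The derivative of `gaussH`. -/
def gaussD (c t z : ℂ) : ℂ := powerSum (fun n : ℕ => ((n : ℂ) + 1) * gaussCoeff c (1 - t) (n + 1)) z

/-- The Euler derivative `z H'` of `gaussH`. -/
def gaussG (c t z : ℂ) : ℂ := powerSum (fun n : ℕ => (n : ℂ) * gaussCoeff c (1 - t) n) z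

/-- The Taylor coefficients of the derivative of `gaussG`. -/
def gaussACoeff (c t : ℂ) (n : ℕ) : ℂ := ((n : ℂ) + 1) ^ 2 * gaussCoeff c (1 - t) (n + 1)

/-- The derivative of `gaussG`. -/
def gaussA (c t z : ℂ) : ℂ := powerSum (gaussACoeff c t) z

/-! ### The functions `H`, `H'`, `zH'` for imaginary `t`, and their behaviour at `1` -/

section
variable {c t : ℂ}

theorem exists_norm_gaussACoeff_le (hc : c ≠ 0) (ht : t.re = 0) :
    ∃ M, ∀ n, ‖gaussACoeff c t n‖ ≤ M := by
  obtain ⟨M, hM⟩ := exists_norm_sq_mul_gaussCoeff_le hc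
  exact ⟨M, hM (1 - t) (by simp [ht])⟩

theorem exists_norm_deriv_gaussCoeff_le (hc : c ≠ 0) (ht : t.re = 0) :
    ∃ M, ∀ n : ℕ, ‖((n : ℂ) + 1) * gaussCoeff c (1 - t) (n + 1)‖ ≤ M := by
  obtain ⟨M, hM⟩ := exists_norm_gaussACoeff_le hc ht
  refine ⟨M, fun n => le_trans ?_ (hM n)⟩
  rw [gaussACoeff, sq, mul_assoc, norm_mul ((n : ℂ) + 1) (_ * _)]
  refine le_mul_of_one_le_left (norm_nonneg _) ?_
  rw [norm_natCast_add_one]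
  simp

theorem exists_norm_gaussCoeff_le (hc : c ≠ 0) (ht : t.re = 0) :
    ∃ M, ∀ n : ℕ, ‖gaussCoeff c (1 - t) n‖ ≤ M := by
  have h := summable_norm_gaussCoeff (C := 1 - t) hc (by simp [ht])
  exact ⟨_, fun n => h.le_tsum n fun _ _ => norm_nonneg _⟩

theorem exists_norm_euler_gaussCoeff_le (hc : c ≠ 0) (ht : t.re = 0) :
    ∃ M, ∀ n : ℕ, ‖(n : ℂ) * gaussCoeff c (1 - t) n‖ ≤ M := by
  obtain ⟨M, hM⟩ := exists_norm_deriv_gaussCoeff_le hc ht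
  refine ⟨M, fun n => ?_⟩
  rcases n with _ | n
  · simpa using (norm_nonneg _).trans (hM 0)
  · simpa using hM n

theorem hasDerivAt_gaussH (hc : c ≠ 0) (ht : t.re = 0) {z : ℂ} (hz : ‖z‖ < 1) :
    HasDerivAt (gaussH c t) (gaussD c t z) z := by
  obtain ⟨M, hM⟩ := exists_norm_deriv_gaussCoeff_le hc ht
  exact hasDerivAt_powerSum hM hz

theorem hasDerivAt_gaussG (hc : c ≠ 0) (ht : t.re = 0) {z : ℂ} (hz : ‖z‖ < 1) :
    HasDerivAt (gaussG c t) (gaussA c t z) z := by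
  obtain ⟨M, hM⟩ := exists_norm_gaussACoeff_le hc ht
  have e : gaussACoeff c t = fun n : ℕ => ((n : ℂ) + 1) *
      (((n + 1 : ℕ) : ℂ) * gaussCoeff c (1 - t) (n + 1)) := by
    funext n; rw [gaussACoeff]; push_cast; ring
  rw [gaussA, e]
  rw [e] at hM
  exact hasDerivAt_powerSum (a := fun n : ℕ => (n : ℂ) * gaussCoeff c (1 - t) n) hM hz

theorem gaussG_eq (hc : c ≠ 0) (ht : t.re = 0) {z : ℂ} (hz : ‖z‖ < 1) :
    gaussG c t z = z * gaussD c t z := by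
  obtain ⟨M, hM⟩ := exists_norm_euler_gaussCoeff_le hc ht
  rw [gaussG, powerSum_eq_zero_add hM hz, gaussD]
  simp

theorem gaussH_zero (hc : c ≠ 0) (ht : t.re = 0) : gaussH c t 0 = 1 := by
  obtain ⟨M, hM⟩ := exists_norm_gaussCoeff_le hc ht
  rw [gaussH, powerSum_eq_zero_add hM (by simp)]
  simp [gaussCoeff]

theorem gaussG_zero (hc : c ≠ 0) (ht : t.re = 0) : gaussG c t 0 = 0 := by
  rw [gaussG_eq hc ht (by simp), zero_mul]

/-- The hypergeometric differential equation. -/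
theorem one_sub_mul_gaussA (hc : c ≠ 0) (ht : t.re = 0) {z : ℂ} (hz : ‖z‖ < 1) :
    (1 - z) * gaussA c t z = t * gaussD c t z - c ^ 2 * gaussH c t z := by
  obtain ⟨M, hM⟩ := exists_norm_gaussACoeff_le hc ht
  obtain ⟨M₁, hM₁⟩ := exists_norm_deriv_gaussCoeff_le hc ht
  obtain ⟨M₂, hM₂⟩ := exists_norm_gaussCoeff_le hc ht
  have hC : ∀ m : ℕ, 1 - t + m ≠ 0 := add_natCast_ne_zero (by simp [ht])
  have h0 : gaussACoeff c t 0 = t * gaussCoeff c (1 - t) 1 - c ^ 2 := by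
    have := hC 0
    simp [gaussACoeff, gaussCoeff] at this ⊢
    field_simp
    ring
  -- The differential equation, in the form `(1 - z)(zH')' = tH' - c²H`, compared coefficientwise.
  have hs : ∀ n : ℕ, gaussACoeff c t (n + 1) = gaussACoeff c t n +
      (t * (((n + 1 : ℕ) : ℂ) + 1) * gaussCoeff c (1 - t) (n + 1 + 1) -
        c ^ 2 * gaussCoeff c (1 - t) (n + 1)) := by
    intro n
    have h1 := hC (n + 1)
    have h2 := natCast_add_one_ne_zero (n + 1)
    rw [gaussACoeff, gaussACoeff, gaussCoeff_succ c (1 - t) (n + 1)]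
    push_cast at h1 h2 ⊢
    field_simp
    ring
  have hA := (summable_powerSum hM hz).hasSum
  have hD := ((summable_powerSum (fun n => hM₁ (n + 1)) hz).hasSum.mul_left t).sub
    ((summable_powerSum (fun n => hM₂ (n + 1)) hz).hasSum.mul_left (c ^ 2))
  have h1 : powerSum (fun n => gaussACoeff c t (n + 1)) z = gaussA c t z +
      (t * powerSum (fun n : ℕ => (((n + 1 : ℕ) : ℂ) + 1) * gaussCoeff c (1 - t) (n + 1 + 1)) z -
        c ^ 2 * powerSum (fun n => gaussCoeff c (1 - t) (n + 1)) z) := by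
    rw [powerSum, gaussA, powerSum, powerSum, powerSum]
    refine HasSum.tsum_eq ?_
    convert hA.add hD using 1
    funext n
    rw [hs]
    ring
  have e := powerSum_eq_zero_add hM hz
  rw [h1, h0] at e
  rw [gaussD, gaussH, powerSum_eq_zero_add hM₁ hz, powerSum_eq_zero_add hM₂ hz, gaussA]
  rw [gaussA] at e
  have e0 : gaussCoeff c (1 - t) 0 = 1 := by simp [gaussCoeff]
  rw [e0]
  simp only [Nat.cast_zero, zero_add, one_mul]
  linear_combination e

theorem tendsto_gaussH (hc : c ≠ 0) (ht : t.re = 0) :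
    Tendsto (fun x : ℝ => gaussH c t x) (𝓝[<] 1) (𝓝 (∑' n, gaussCoeff c (1 - t) n)) := by
  have h := (summable_norm_gaussCoeff (C := 1 - t) hc (by simp [ht])).of_norm.hasSum
  exact tendsto_map'_iff.1 (Complex.tendsto_tsum_powerSeries_nhdsWithin_lt h.tendsto_sum_nat)

theorem sin_pi_mul_div_ne_zero (ht : t.re = 0) (ht0 : t ≠ 0) :
    Complex.sin (Real.pi * t) / (Real.pi * t) ≠ 0 := by
  have hpi : (Real.pi : ℂ) ≠ 0 := by exact_mod_cast Real.pi_ne_zero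
  refine div_ne_zero (fun h => ?_) (mul_ne_zero hpi ht0)
  obtain ⟨k, hk⟩ := Complex.sin_eq_zero_iff.1 h
  have h1 : t = k := mul_left_cancel₀ hpi (by rw [hk]; ring)
  rw [h1, Complex.intCast_re] at ht
  exact ht0 (by rw [h1]; exact_mod_cast ht)

/-- The limit of `(1 - x) ^ (1 + t) G'(x)` as `x → 1⁻`. -/
def gaussLimit (c t : ℂ) : ℂ :=
  -c ^ 2 * (Complex.sin (Real.pi * c) / (Real.pi * c)) *
    (Complex.sin (Real.pi * t) / (Real.pi * t))⁻¹

/-- Multiplying numerator and denominator by `binomCoeff (-t) (n + 1)` turns both into Euler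
products, up to the factor `1 - t/(n + 1) → 1`. -/
theorem tendsto_gaussACoeff_div (hc : c ≠ 0) (ht : t.re = 0) (ht0 : t ≠ 0) :
    Tendsto (fun n => gaussACoeff c t n / binomCoeff t n) atTop (𝓝 (gaussLimit c t)) := by
  have h1 : Tendsto (fun n : ℕ => 1 + -t / ((n : ℂ) + 1)) atTop (𝓝 1) := by
    have h := (tendsto_one_div_add_atTop_nhds_zero_nat (𝕜 := ℂ)).const_mul (-t)
    simpa [div_eq_mul_inv] using h.const_add 1
  have h2 := ((tendsto_eulerSinProd hc).const_mul (-c ^ 2)).mul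
    (((tendsto_eulerSinProd ht0).mul h1).inv₀ (by simpa using sin_pi_mul_div_ne_zero ht ht0))
  rw [mul_one] at h2
  refine h2.congr fun n => ?_
  have h3 := gaussCoeff_mul_binomCoeff (c := c) ht n
  have h4 := binomCoeff_ne_zero (t := -t) (by simp [ht]) (n + 1)
  have h5 := binomCoeff_ne_zero ht n
  rw [gaussACoeff, ← h3, ← binomCoeff_mul_neg, mul_assoc (binomCoeff t n), ← binomCoeff_succ]
  field_simp

theorem norm_cpow_one_add {x : ℝ} (hx : 0 < x) (ht : t.re = 0) : ‖(x : ℂ) ^ (1 + t)‖ = x := by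
  rw [Complex.norm_cpow_eq_rpow_re_of_pos hx]
  simp [ht]

/-- An Abelian comparison: the multiple of `binomCoeff t` sums exactly to a multiple of `(1 -
x)^{-(1+t)}`. The remaining coefficients tend to `0`, so their sum is `o(1/(1 - x))`, while `|(1 -
x)^{1+t}| = 1 - x`. -/
theorem tendsto_cpow_mul_gaussA (hc : c ≠ 0) (ht : t.re = 0) (ht0 : t ≠ 0) :
    Tendsto (fun x : ℝ => ((1 - x : ℝ) : ℂ) ^ (1 + t) * gaussA c t x) (𝓝[<] 1)
      (𝓝 (gaussLimit c t)) := by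
  obtain ⟨M, hM⟩ := exists_norm_gaussACoeff_le hc ht
  obtain ⟨M', hM'⟩ := exists_norm_binomCoeff_le ht ht0
  set r := fun n => gaussACoeff c t n - gaussLimit c t * binomCoeff t n with hr
  have hr0 : Tendsto r atTop (𝓝 0) := by
    have h1 : Tendsto (fun n => gaussACoeff c t n / binomCoeff t n - gaussLimit c t) atTop
        (𝓝 0) := by
      simpa using (tendsto_gaussACoeff_div hc ht ht0).sub_const (gaussLimit c t)
    have h2 := NormedField.tendsto_zero_smul_of_tendsto_zero_of_bounded h1
      (Filter.isBoundedUnder_of ⟨M', hM'⟩)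
    refine h2.congr fun n => ?_
    have := binomCoeff_ne_zero ht n
    simp only [Pi.smul_apply', smul_eq_mul, hr]
    field_simp
  have h3 : Tendsto (fun x : ℝ => ((1 - x : ℝ) : ℂ) ^ (1 + t) * powerSum r x) (𝓝[<] 1) (𝓝 0) := by
    rw [tendsto_zero_iff_norm_tendsto_zero]
    refine (tendsto_one_sub_mul_powerSum hr0).congr' ?_
    filter_upwards [self_mem_nhdsWithin] with x hx
    rw [norm_mul, norm_cpow_one_add (sub_pos.2 hx) ht]
  have h4 := h3.add_const (gaussLimit c t)
  rw [zero_add] at h4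
  refine h4.congr' ?_
  filter_upwards [self_mem_nhdsWithin, mem_nhdsWithin_of_mem_nhds (lt_mem_nhds (zero_lt_one' ℝ))]
    with x hx1 hx0
  have hx : ‖(x : ℂ)‖ < 1 := by rw [Complex.norm_real, Real.norm_of_nonneg hx0.le]; exact hx1
  have e : powerSum r x = gaussA c t x - gaussLimit c t * powerSum (binomCoeff t) x := by
    have hs := (summable_powerSum hM hx).hasSum.sub
      ((summable_powerSum hM' hx).hasSum.mul_left (gaussLimit c t))
    refine (tsum_congr fun n => ?_).trans hs.tsum_eq
    simp only [hr]
    ring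
  rw [e]
  linear_combination (-gaussLimit c t) * powerSum_binomCoeff t hx0.le hx1

/-- The differential equation gives `tG - c²H = x(1 - x)G' - c²(1 - x)H`, and the last term is
negligible. -/
theorem tendsto_cpow_mul_gaussG_sub (hc : c ≠ 0) (ht : t.re = 0) (ht0 : t ≠ 0) :
    Tendsto (fun x : ℝ => ((1 - x : ℝ) : ℂ) ^ t * (t * gaussG c t x - c ^ 2 * gaussH c t x))
      (𝓝[<] 1) (𝓝 (gaussLimit c t)) := by
  have hx1 : Tendsto (fun x : ℝ => (x : ℂ)) (𝓝[<] 1) (𝓝 1) :=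
    (Complex.continuous_ofReal.tendsto' 1 1 (by simp)).mono_left nhdsWithin_le_nhds
  have h0 : Tendsto (fun x : ℝ => ((1 - x : ℝ) : ℂ) ^ (1 + t)) (𝓝[<] 1) (𝓝 0) := by
    rw [tendsto_zero_iff_norm_tendsto_zero]
    have h : Tendsto (fun x : ℝ => 1 - x) (𝓝[<] 1) (𝓝 0) :=
      (Continuous.tendsto' (by fun_prop) 1 0 (by simp)).mono_left nhdsWithin_le_nhds
    refine h.congr' ?_
    filter_upwards [self_mem_nhdsWithin] with x hx
    rw [norm_cpow_one_add (sub_pos.2 hx) ht]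
  have h := (hx1.mul (tendsto_cpow_mul_gaussA hc ht ht0)).sub
    ((h0.mul (tendsto_gaussH hc ht)).const_mul (c ^ 2))
  rw [zero_mul, mul_zero, sub_zero, one_mul] at h
  refine h.congr' ?_
  filter_upwards [self_mem_nhdsWithin, mem_nhdsWithin_of_mem_nhds (lt_mem_nhds (zero_lt_one' ℝ))]
    with x hx1 hx0
  have hx : ‖(x : ℂ)‖ < 1 := by rw [Complex.norm_real, Real.norm_of_nonneg hx0.le]; exact hx1
  have h1x : ((1 - x : ℝ) : ℂ) ≠ 0 := by exact_mod_cast (sub_pos.2 hx1).ne'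
  rw [Complex.cpow_add _ _ h1x, Complex.cpow_one, gaussG_eq hc ht hx]
  have e := one_sub_mul_gaussA hc ht hx
  push_cast
  linear_combination x * (1 - (x : ℂ)) ^ t * e

end

/-! ### The Lax system and Jost solutions -/

/-- `(u, v)` is a column solution of the Lax system. -/
def IsLaxColumn (q : ℝ → ℂ) (c : ℂ) (k : ℝ) (u v : ℝ → ℂ) : Prop :=
  ∀ x, HasDerivAt u (-(Complex.I * k) * u x + c * q x * v x) x ∧
    HasDerivAt v (Complex.I * k * v x + c * conj (q x) * u x) x

/-- All columns of `Ψ` solve the Lax system. -/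
def IsLaxSolution (q : ℝ → ℂ) (c : ℂ) (k : ℝ) (Ψ : ℝ → Matrix (Fin 2) (Fin 2) ℂ) : Prop :=
  ∀ j, IsLaxColumn q c k (fun x => Ψ x 0 j) (fun x => Ψ x 1 j)

theorem lax_apply_zero (c u : ℂ) (k : ℝ) (A : Matrix (Fin 2) (Fin 2) ℂ) (j : Fin 2) :
    ((-(Complex.I * k)) • sigma3 * A + laxW c u * A) 0 j =
      -(Complex.I * k) * A 0 j + c * u * A 1 j := by
  rw [Matrix.add_apply, Matrix.mul_apply, Matrix.mul_apply, Fin.sum_univ_two, Fin.sum_univ_two]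
  simp [sigma3, laxW]

theorem lax_apply_one (c u : ℂ) (k : ℝ) (A : Matrix (Fin 2) (Fin 2) ℂ) (j : Fin 2) :
    ((-(Complex.I * k)) • sigma3 * A + laxW c u * A) 1 j =
      Complex.I * k * A 1 j + c * conj u * A 0 j := by
  rw [Matrix.add_apply, Matrix.mul_apply, Matrix.mul_apply, Fin.sum_univ_two, Fin.sum_univ_two]
  simp [sigma3, laxW]

theorem isJost_iff {l : Filter ℝ} {q : ℝ → ℂ} {c : ℂ} {ρ φ k μ : ℝ}
    {Ψ : ℝ → Matrix (Fin 2) (Fin 2) ℂ} : IsJost l q c ρ φ k μ Ψ ↔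
      IsLaxSolution q c k Ψ ∧ Tendsto (fun x => (asymE c ρ φ k μ x)⁻¹ * Ψ x) l (𝓝 1) := by
  refine and_congr_left' ⟨fun h j x => ⟨?_, ?_⟩, fun h x => ?_⟩
  · rw [← lax_apply_zero]
    exact h x 0 j
  · rw [← lax_apply_one]
    exact h x 1 j
  · rw [Fin.forall_fin_two]
    refine ⟨fun j => ?_, fun j => ?_⟩
    · rw [lax_apply_zero]
      exact (h j x).1
    · rw [lax_apply_one]
      exact (h j x).2

/-- The coefficient matrix of the Lax system has trace zero. -/
theorem IsLaxColumn.wronskian_eq {q : ℝ → ℂ} {c : ℂ} {k : ℝ} {u v u' v' : ℝ → ℂ}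
    (h : IsLaxColumn q c k u v) (h' : IsLaxColumn q c k u' v') (x y : ℝ) :
    u x * v' x - v x * u' x = u y * v' y - v y * u' y := by
  have hd : ∀ z, HasDerivAt (fun z => u z * v' z - v z * u' z) 0 z := fun z => by
    convert! ((h z).1.mul (h' z).2).sub ((h z).2.mul (h' z).1) using 1
    ring
  exact is_const_of_deriv_eq_zero (fun z => (hd z).differentiableAt) (fun z => (hd z).deriv) x y

theorem IsLaxSolution.adjugate_mul_eq {q : ℝ → ℂ} {c : ℂ} {k : ℝ}
    {Ψ Φ : ℝ → Matrix (Fin 2) (Fin 2) ℂ} (hΨ : IsLaxSolution q c k Ψ)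
    (hΦ : IsLaxSolution q c k Φ) (x y : ℝ) :
    (Ψ x).adjugate * Φ x = (Ψ y).adjugate * Φ y := by
  ext i j
  fin_cases i
  · have := (hΨ 1).wronskian_eq (hΦ j) x y
    simp [Matrix.adjugate_fin_two, Matrix.mul_apply, Fin.sum_univ_two]
    linear_combination -this
  · have := (hΨ 0).wronskian_eq (hΦ j) x y
    simp [Matrix.adjugate_fin_two, Matrix.mul_apply, Fin.sum_univ_two]
    linear_combination this

theorem IsLaxColumn.linear_comb {q : ℝ → ℂ} {c : ℂ} {k : ℝ} {u v u' v' : ℝ → ℂ}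
    (h : IsLaxColumn q c k u v) (h' : IsLaxColumn q c k u' v') (m n : ℂ) :
    IsLaxColumn q c k (fun x => u x * m + u' x * n) (fun x => v x * m + v' x * n) := by
  refine fun x => ⟨?_, ?_⟩
  · convert! ((h x).1.mul_const m).add ((h' x).1.mul_const n) using 1
    ring
  · convert! ((h x).2.mul_const m).add ((h' x).2.mul_const n) using 1
    ring

theorem IsLaxSolution.mul_const {q : ℝ → ℂ} {c : ℂ} {k : ℝ}
    {Ψ : ℝ → Matrix (Fin 2) (Fin 2) ℂ} (hΨ : IsLaxSolution q c k Ψ)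
    (N : Matrix (Fin 2) (Fin 2) ℂ) : IsLaxSolution q c k fun x => Ψ x * N := by
  intro j
  simp only [Matrix.mul_apply, Fin.sum_univ_two]
  exact (hΨ 0).linear_comb (hΨ 1) _ _

/-- The Lax system has the symmetry `(u, v) ↦ (v^*, (c^* / c) u^*)` when `c² ∈ ℝ`. -/
theorem IsLaxColumn.conj_swap {q : ℝ → ℂ} {c : ℂ} {k : ℝ} {u v : ℝ → ℂ} (hc : c ≠ 0)
    (hc2 : conj c ^ 2 = c ^ 2) (h : IsLaxColumn q c k u v) :
    IsLaxColumn q c k (fun x => conj (v x)) (fun x => conj c / c * conj (u x)) := by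
  refine fun x => ⟨?_, ?_⟩
  · convert! (h x).2.star using 1
    simp only [star_add, star_mul', Complex.star_def, Complex.conj_I, Complex.conj_ofReal,
      Complex.conj_conj]
    field_simp
  · convert! (h x).1.star.const_mul (conj c / c) using 1
    simp only [star_add, star_mul', star_neg, Complex.star_def, Complex.conj_I,
      Complex.conj_ofReal]
    field_simp
    linear_combination (-conj (q x) * conj (v x)) * hc2

/-- The off-diagonal entry `i (μ - k) / (c ρ)` of the asymptotic eigenvector matrix. -/
def asymEntry (c : ℂ) (ρ k μ : ℝ) : ℂ := Complex.I * (μ - k) / (c * ρ)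

theorem asymE_eq (c : ℂ) (ρ φ k μ x : ℝ) : asymE c ρ φ k μ x =
    !![Complex.exp (Complex.I * (φ / 2)) * Complex.exp (-(Complex.I * (μ * x))),
       asymEntry c ρ k μ * Complex.exp (Complex.I * (φ / 2)) * Complex.exp (Complex.I * (μ * x));
       -(asymEntry c ρ k μ * Complex.exp (-(Complex.I * (φ / 2))) *
        Complex.exp (-(Complex.I * (μ * x)))),
       Complex.exp (-(Complex.I * (φ / 2))) * Complex.exp (Complex.I * (μ * x))] := by
  ext i j
  fin_cases i <;> fin_cases j <;>
    simp [asymE, asymP, expSigma3, asymEntry, Matrix.mul_apply, Fin.sum_univ_two] <;> ring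

theorem asymE_det (c : ℂ) (ρ φ k μ x : ℝ) :
    (asymE c ρ φ k μ x).det = 1 + asymEntry c ρ k μ ^ 2 := by
  have h1 : Complex.exp (Complex.I * (φ / 2)) * Complex.exp (-(Complex.I * (φ / 2))) = 1 := by
    rw [← Complex.exp_add, add_neg_cancel, Complex.exp_zero]
  have h2 : Complex.exp (Complex.I * (μ * x)) * Complex.exp (-(Complex.I * (μ * x))) = 1 := by
    rw [← Complex.exp_add, add_neg_cancel, Complex.exp_zero]
  rw [asymE_eq, Matrix.det_fin_two_of]
  generalize Complex.exp (Complex.I * (φ / 2)) = e at *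
  generalize Complex.exp (-(Complex.I * (φ / 2))) = e' at *
  generalize Complex.exp (Complex.I * (μ * x)) = f at *
  generalize Complex.exp (-(Complex.I * (μ * x))) = f' at *
  linear_combination (1 + asymEntry c ρ k μ ^ 2) * f * f' * h1 +
    (1 + asymEntry c ρ k μ ^ 2) * h2

/-! ### Uniqueness of Jost solutions and the scattering matrix -/

section
variable {c : ℂ} {ρ k μ : ℝ}

theorem mul_asymEntry (hc : c ≠ 0) (hρ : ρ ≠ 0) :
    c * ρ * asymEntry c ρ k μ = Complex.I * (μ - k) := by
  have : (ρ : ℂ) ≠ 0 := by exact_mod_cast hρ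
  rw [asymEntry]; field_simp

/-- The dispersion relation made linear in `p`; with `mul_asymEntry` it expresses that the columns
of `P` are eigenvectors. -/
theorem asymEntry_mul_add (hc : c ≠ 0) (hρ : ρ ≠ 0)
    (hμ : (μ : ℂ) ^ 2 = (k : ℂ) ^ 2 - c ^ 2 * (ρ : ℂ) ^ 2) :
    Complex.I * (μ + k) * asymEntry c ρ k μ = c * ρ := by
  have hρ' : (ρ : ℂ) ≠ 0 := by exact_mod_cast hρ
  have h0 : c * (ρ : ℂ) ≠ 0 := mul_ne_zero hc hρ'
  refine mul_left_cancel₀ h0 ?_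
  linear_combination Complex.I * (μ + k) * mul_asymEntry (k := k) (μ := μ) hc hρ - hμ +
    (μ ^ 2 - k ^ 2) * Complex.I_sq

/-- In fact `(μ + k)(1 + p²) = 2μ`. -/
theorem one_add_asymEntry_sq_ne_zero (hc : c ≠ 0) (hρ : ρ ≠ 0) (hμ0 : μ ≠ 0)
    (hμ : (μ : ℂ) ^ 2 = (k : ℂ) ^ 2 - c ^ 2 * (ρ : ℂ) ^ 2) : 1 + asymEntry c ρ k μ ^ 2 ≠ 0 := by
  have hρ' : (ρ : ℂ) ≠ 0 := by exact_mod_cast hρ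
  have hμ0' : (μ : ℂ) ≠ 0 := by exact_mod_cast hμ0
  have h0 : c * (ρ : ℂ) ≠ 0 := mul_ne_zero hc hρ'
  have h1 := mul_asymEntry (k := k) (μ := μ) hc hρ
  have h2 := asymEntry_mul_add hc hρ hμ
  intro h
  have h3 : 2 * (μ : ℂ) * (c * ρ) = 0 := by
    linear_combination (c * ρ * (μ + k)) * h - (μ + k) * asymEntry c ρ k μ * h1 - (μ - k) * h2
  exact mul_ne_zero (mul_ne_zero two_ne_zero hμ0') h0 h3

theorem asymE_isUnit_det (hc : c ≠ 0) (hρ : ρ ≠ 0) (hμ0 : μ ≠ 0)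
    (hμ : (μ : ℂ) ^ 2 = (k : ℂ) ^ 2 - c ^ 2 * (ρ : ℂ) ^ 2) (φ x : ℝ) :
    IsUnit (asymE c ρ φ k μ x).det := by
  rw [asymE_det, isUnit_iff_ne_zero]
  exact one_add_asymEntry_sq_ne_zero hc hρ hμ0 hμ

variable {q : ℝ → ℂ} {l : Filter ℝ} {φ : ℝ} {Ψ Φ : ℝ → Matrix (Fin 2) (Fin 2) ℂ}

/-- The entries of `adj(Ψ) Φ` are Wronskians, hence constant, so the product equals its limit along
`l`; `det E` depends neither on `x` nor on the phase. -/
theorem adjugate_mul_eq_of_tendsto [l.NeBot] (hc : c ≠ 0) (hρ : ρ ≠ 0) (hμ0 : μ ≠ 0)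
    (hμ : (μ : ℂ) ^ 2 = (k : ℂ) ^ 2 - c ^ 2 * (ρ : ℂ) ^ 2) {N N' : Matrix (Fin 2) (Fin 2) ℂ}
    (hΨ : IsLaxSolution q c k Ψ) (hΦ : IsLaxSolution q c k Φ)
    (hN : Tendsto (fun x => (asymE c ρ φ k μ x)⁻¹ * Ψ x) l (𝓝 N))
    (hN' : Tendsto (fun x => (asymE c ρ φ k μ x)⁻¹ * Φ x) l (𝓝 N')) (x : ℝ) :
    (Ψ x).adjugate * Φ x = (1 + asymEntry c ρ k μ ^ 2) • (N.adjugate * N') := by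
  have hadj : Tendsto (fun x => ((asymE c ρ φ k μ x)⁻¹ * Ψ x).adjugate) l (𝓝 N.adjugate) :=
    ((continuous_id.matrix_adjugate).tendsto N).comp hN
  have h := (hadj.mul hN').const_smul (1 + asymEntry c ρ k μ ^ 2)
  refine tendsto_nhds_unique (tendsto_const_nhds.congr fun y => ?_) h
  have hu := asymE_isUnit_det hc hρ hμ0 hμ φ y
  rw [hΨ.adjugate_mul_eq hΦ x y]
  have e1 : ∀ X : Matrix (Fin 2) (Fin 2) ℂ,
      asymE c ρ φ k μ y * ((asymE c ρ φ k μ y)⁻¹ * X) = X := fun X => by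
    rw [← mul_assoc, Matrix.mul_nonsing_inv _ hu, one_mul]
  conv_lhs => rw [← e1 (Ψ y), ← e1 (Φ y), Matrix.adjugate_mul_distrib, mul_assoc,
    ← mul_assoc (asymE c ρ φ k μ y).adjugate, Matrix.adjugate_mul, asymE_det, smul_mul_assoc,
    one_mul, mul_smul_comm]

theorem IsJost.eq_mul_of_tendsto [l.NeBot] (hc : c ≠ 0) (hρ : ρ ≠ 0) (hμ0 : μ ≠ 0)
    (hμ : (μ : ℂ) ^ 2 = (k : ℂ) ^ 2 - c ^ 2 * (ρ : ℂ) ^ 2) {N : Matrix (Fin 2) (Fin 2) ℂ}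
    (hΨ : IsJost l q c ρ φ k μ Ψ) (hΦ : IsLaxSolution q c k Φ)
    (hN : Tendsto (fun x => (asymE c ρ φ k μ x)⁻¹ * Φ x) l (𝓝 N)) (x : ℝ) :
    Φ x = Ψ x * N := by
  obtain ⟨hΨ1, hΨ2⟩ := isJost_iff.1 hΨ
  have hδ := one_add_asymEntry_sq_ne_zero hc hρ hμ0 hμ
  have h1 := adjugate_mul_eq_of_tendsto hc hρ hμ0 hμ hΨ1 hΨ1 hΨ2 hΨ2 x
  have h2 := adjugate_mul_eq_of_tendsto hc hρ hμ0 hμ hΨ1 hΦ hΨ2 hN x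
  rw [Matrix.adjugate_one, one_mul] at h1 h2
  have h3 : (Ψ x).det = 1 + asymEntry c ρ k μ ^ 2 := by
    rw [Matrix.adjugate_mul] at h1
    simpa using congrFun (congrFun h1 0) 0
  have h4 := congrArg (Ψ x * ·) h2
  simp only [← mul_assoc, Matrix.mul_adjugate, h3, smul_mul_assoc, one_mul, mul_smul_comm] at h4
  exact smul_right_injective _ hδ h4

theorem IsJost.unique [l.NeBot] (hc : c ≠ 0) (hρ : ρ ≠ 0) (hμ0 : μ ≠ 0)
    (hμ : (μ : ℂ) ^ 2 = (k : ℂ) ^ 2 - c ^ 2 * (ρ : ℂ) ^ 2)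
    (hΨ : IsJost l q c ρ φ k μ Ψ) (hΦ : IsJost l q c ρ φ k μ Φ) : Φ = Ψ := by
  obtain ⟨h1, h2⟩ := isJost_iff.1 hΦ
  funext x
  rw [hΨ.eq_mul_of_tendsto hc hρ hμ0 hμ h1 h2 x, mul_one]

/-- Existence of `Ψ⁻` and uniqueness of the scattering matrix, from the limit of `E₋⁻¹ Ψ⁺`. -/
theorem scattering_of_tendsto {θm θp : ℝ} (hc : c ≠ 0) (hρ : ρ ≠ 0) (hμ0 : μ ≠ 0)
    (hμ : (μ : ℂ) ^ 2 = (k : ℂ) ^ 2 - c ^ 2 * (ρ : ℂ) ^ 2) {S : Matrix (Fin 2) (Fin 2) ℂ}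
    (hΨ : IsJost atTop q c ρ θp k μ Ψ)
    (hS : Tendsto (fun x => (asymE c ρ θm k μ x)⁻¹ * Ψ x) atBot (𝓝 S)) :
    (∃! Ψp, IsJost atTop q c ρ θp k μ Ψp) ∧ (∃! Ψm, IsJost atBot q c ρ θm k μ Ψm) ∧
      (∀ S', IsScatteringMatrix q c ρ θm θp k μ S' ↔ S' = S) ∧
      ∀ Ψp, IsJost atTop q c ρ θp k μ Ψp →
        Tendsto (fun x => (asymE c ρ θm k μ x)⁻¹ * Ψp x) atBot (𝓝 S) := by
  obtain ⟨h1, h2⟩ := isJost_iff.1 hΨ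
  have hδ := one_add_asymEntry_sq_ne_zero hc hρ hμ0 hμ
  -- `adj(Ψ⁺) Ψ⁺` is evaluated at both ends, where `det E` is the same.
  have hdet : S.det = 1 := by
    have e1 := adjugate_mul_eq_of_tendsto hc hρ hμ0 hμ h1 h1 h2 h2 0
    have e2 := adjugate_mul_eq_of_tendsto hc hρ hμ0 hμ h1 h1 hS hS 0
    rw [e1] at e2
    have e3 := smul_right_injective _ hδ e2
    rw [Matrix.adjugate_one, one_mul, Matrix.adjugate_mul] at e3
    simpa using (congrFun (congrFun e3 0) 0).symm
  have hu : IsUnit S.det := by rw [hdet]; exact isUnit_one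
  have hΨm : IsJost atBot q c ρ θm k μ fun x => Ψ x * S⁻¹ := by
    refine isJost_iff.2 ⟨h1.mul_const _, ?_⟩
    have h := hS.mul_const S⁻¹
    rw [Matrix.mul_nonsing_inv _ hu] at h
    simpa only [mul_assoc] using h
  refine ⟨⟨Ψ, hΨ, fun Φ hΦ => hΨ.unique hc hρ hμ0 hμ hΦ⟩,
    ⟨_, hΨm, fun Φ hΦ => hΨm.unique hc hρ hμ0 hμ hΦ⟩, fun S' => ⟨?_, ?_⟩, fun Φ hΦ => ?_⟩
  · rintro ⟨Ψp, Ψm, hp, hm, h⟩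
    obtain rfl := hΨ.unique hc hρ hμ0 hμ hp
    refine tendsto_nhds_unique ?_ hS
    have h3 := (isJost_iff.1 hm).2.mul_const S'
    rw [one_mul] at h3
    refine h3.congr fun x => ?_
    rw [h, mul_assoc]
  · rintro rfl
    refine ⟨Ψ, _, hΨ, hΨm, fun x => ?_⟩
    rw [mul_assoc, Matrix.nonsing_inv_mul _ hu, mul_one]
  · rw [hΨ.unique hc hρ hμ0 hμ hΦ]
    exact hS

end

/-! ### The logistic function -/

/-- The decreasing logistic function `1 / (1 + e^{νx})`. -/
def logisticW (ν x : ℝ) : ℝ := (1 + Real.exp (ν * x))⁻¹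

theorem logisticW_pos (ν x : ℝ) : 0 < logisticW ν x := by
  rw [logisticW]; positivity

theorem one_sub_logisticW (ν x : ℝ) : 1 - logisticW ν x = Real.exp (ν * x) * logisticW ν x := by
  have : 0 < Real.exp (ν * x) := Real.exp_pos _
  rw [logisticW]; field_simp; ring

theorem one_sub_logisticW_pos (ν x : ℝ) : 0 < 1 - logisticW ν x := by
  rw [one_sub_logisticW]
  exact mul_pos (Real.exp_pos _) (logisticW_pos ν x)

theorem norm_logisticW_lt (ν x : ℝ) : ‖(logisticW ν x : ℂ)‖ < 1 := by
  rw [Complex.norm_real, Real.norm_of_nonneg (logisticW_pos ν x).le]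
  linarith [one_sub_logisticW_pos ν x]

theorem hasDerivAt_logisticW (ν x : ℝ) :
    HasDerivAt (logisticW ν) (-(ν * logisticW ν x * (1 - logisticW ν x))) x := by
  have h : HasDerivAt (fun y => 1 + Real.exp (ν * y)) (Real.exp (ν * x) * ν) x := by
    simpa using (((hasDerivAt_id x).const_mul ν).exp).const_add 1
  have h0 : 0 < 1 + Real.exp (ν * x) := by positivity
  convert! h.inv h0.ne' using 1
  rw [one_sub_logisticW, logisticW]
  field_simp

theorem tendsto_logisticW_atTop {ν : ℝ} (hν : 0 < ν) : Tendsto (logisticW ν) atTop (𝓝 0) := by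
  refine tendsto_inv_atTop_zero.comp (tendsto_const_nhds.add_atTop ?_)
  exact Real.tendsto_exp_atTop.comp (tendsto_id.const_mul_atTop hν)

theorem tendsto_logisticW_atBot {ν : ℝ} (hν : 0 < ν) : Tendsto (logisticW ν) atBot (𝓝[<] 1) := by
  refine tendsto_nhdsWithin_iff.2 ⟨?_, Eventually.of_forall fun x => ?_⟩
  · have h : Tendsto (fun x => Real.exp (ν * x)) atBot (𝓝 0) :=
      Real.tendsto_exp_atBot.comp (tendsto_id.const_mul_atBot hν)
    have h1 := (h.const_add 1).inv₀ (by norm_num)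
    rw [add_zero, inv_one] at h1
    exact h1
  · exact sub_pos.1 (one_sub_logisticW_pos ν x)

theorem solitonData_eq (ρ θ ν x : ℝ) : solitonData ρ θ ν x =
    ρ * (Complex.exp (Complex.I * θ) + logisticW ν x * (1 - Complex.exp (Complex.I * θ))) := by
  have h : (1 : ℂ) + Complex.exp (ν * x) ≠ 0 := by
    have h0 : 0 < 1 + Real.exp (ν * x) := by positivity
    exact_mod_cast h0.ne'
  rw [solitonData, logisticW]
  push_cast
  field_simp
  ring

/-! ### The explicit Jost column -/

/-- The matrix with second column `(u, v)` and first column its image `(v^*, (c^* / c) u^*)` under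
the conjugation symmetry. -/
def conjMatrix (c u v : ℂ) : Matrix (Fin 2) (Fin 2) ℂ := !![conj v, u; conj c / c * conj u, v]

theorem continuous_conjMatrix (c : ℂ) : Continuous fun z : ℂ × ℂ => conjMatrix c z.1 z.2 := by
  refine continuous_matrix fun i j => ?_
  fin_cases i <;> fin_cases j <;> simp [conjMatrix] <;> fun_prop

theorem IsLaxColumn.isLaxSolution {q : ℝ → ℂ} {c : ℂ} {k : ℝ} {u v : ℝ → ℂ} (hc : c ≠ 0)
    (hc2 : conj c ^ 2 = c ^ 2) (h : IsLaxColumn q c k u v) :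
    IsLaxSolution q c k fun x => conjMatrix c (u x) (v x) := by
  intro j
  fin_cases j
  · exact h.conj_swap hc hc2
  · exact h

/-- `E` is compatible with the conjugation symmetry, so asymptotics need only be computed for the
second column. -/
theorem asymE_mul_conjMatrix {c : ℂ} (hc : c ≠ 0) (hc2 : conj c ^ 2 = c ^ 2) (ρ φ k μ x : ℝ)
    (a₁ a₂ : ℂ) : asymE c ρ φ k μ x * conjMatrix c a₁ a₂ =
      conjMatrix c (asymE c ρ φ k μ x 0 0 * a₁ + asymE c ρ φ k μ x 0 1 * a₂)
        (asymE c ρ φ k μ x 1 0 * a₁ + asymE c ρ φ k μ x 1 1 * a₂) := by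
  have hp : conj (asymEntry c ρ k μ) = -(conj c / c * asymEntry c ρ k μ) := by
    have hcc : conj c ≠ 0 := by simpa using hc
    simp only [asymEntry, map_div₀, map_mul, map_sub, Complex.conj_I, Complex.conj_ofReal]
    rw [show -Complex.I * ((μ : ℂ) - k) / (conj c * ρ) =
      -(Complex.I * (μ - k)) * conj c / (conj c ^ 2 * ρ) by field_simp, hc2]
    field_simp
  have hp' : conj c / c * (conj c / c) = 1 := by
    rw [div_mul_div_comm, ← sq, ← sq, hc2, div_self (pow_ne_zero 2 hc)]
  have h1 : conj (Complex.exp (Complex.I * (φ / 2))) = Complex.exp (-(Complex.I * (φ / 2))) := by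
    rw [← Complex.exp_conj]; simp [Complex.conj_ofNat]
  have h2 : conj (Complex.exp (-(Complex.I * (φ / 2)))) = Complex.exp (Complex.I * (φ / 2)) := by
    rw [← Complex.exp_conj]; simp [Complex.conj_ofNat]
  have h3 : conj (Complex.exp (Complex.I * (μ * x))) = Complex.exp (-(Complex.I * (μ * x))) := by
    rw [← Complex.exp_conj]; simp
  have h4 : conj (Complex.exp (-(Complex.I * (μ * x)))) = Complex.exp (Complex.I * (μ * x)) := by
    rw [← Complex.exp_conj]; simp
  rw [asymE_eq]
  ext i j
  fin_cases i <;> fin_cases j <;>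
    simp only [conjMatrix, Matrix.mul_apply, Fin.sum_univ_two, Matrix.of_apply, Matrix.cons_val',
      Matrix.cons_val_zero, Matrix.cons_val_one, Matrix.cons_val_fin_one, Fin.zero_eta, Fin.mk_one,
      Fin.isValue, map_add, map_mul, map_neg, hp, h1, h2, h3, h4]
  · ring
  · linear_combination (asymEntry c ρ k μ * Complex.exp (-(Complex.I * (φ / 2))) *
      Complex.exp (-(Complex.I * (μ * x))) * conj a₂) * hp'

/-- The first component of the Jost column `E₊ (0, 1)ᵀ + o(1)`. -/
def jostU (c t : ℂ) (ρ θ ν k μ x : ℝ) : ℂ :=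
  Complex.exp (Complex.I * (μ * x)) *
    (gaussH c t (logisticW ν x) * Complex.exp (Complex.I * (θ / 2)) * asymEntry c ρ k μ -
      Complex.I / c * gaussG c t (logisticW ν x))

/-- The second component of the Jost column `E₊ (0, 1)ᵀ + o(1)`. -/
def jostV (c t : ℂ) (ρ θ ν k μ x : ℝ) : ℂ :=
  Complex.exp (Complex.I * (μ * x)) *
    (gaussH c t (logisticW ν x) * Complex.exp (-(Complex.I * (θ / 2))) +
      Complex.I / c * asymEntry c ρ k μ * gaussG c t (logisticW ν x))

theorem exp_mul_I_half (θ : ℝ) :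
    Complex.exp (Complex.I * (θ / 2)) = Real.cos (θ / 2) + Real.sin (θ / 2) * Complex.I := by
  rw [mul_comm, Complex.exp_mul_I]; push_cast; rfl

theorem exp_neg_mul_I_half (θ : ℝ) :
    Complex.exp (-(Complex.I * (θ / 2))) = Real.cos (θ / 2) - Real.sin (θ / 2) * Complex.I := by
  rw [show -(Complex.I * ((θ : ℂ) / 2)) = (-(θ / 2)) * Complex.I by ring, Complex.exp_mul_I,
    Complex.cos_neg, Complex.sin_neg]
  push_cast; ring

section
variable {c t : ℂ} {ρ θ ν k μ : ℝ}

theorem re_eq_zero_of_mul_eq (hν0 : ν ≠ 0) (ht : t * ν = 2 * Complex.I * μ) : t.re = 0 := by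
  have := congrArg Complex.re ht
  simpa [hν0] using this

theorem ne_zero_of_mul_eq (hμ0 : μ ≠ 0) (ht : t * ν = 2 * Complex.I * μ) : t ≠ 0 := by
  rintro rfl
  simp [hμ0] at ht

/-- After differentiation, each component is a polynomial identity modulo `G = wH'`, the
hypergeometric equation, the two relations for `p`, and the relations between `e^{±iθ/2}`, `ν` and
`ρ`. -/
theorem isLaxColumn_jost (hc : c ≠ 0) (hρ : ρ ≠ 0) (hν0 : ν ≠ 0)
    (hν : ν = 2 * ρ * Real.sin (θ / 2))
    (hμ : (μ : ℂ) ^ 2 = (k : ℂ) ^ 2 - c ^ 2 * (ρ : ℂ) ^ 2) (ht : t * ν = 2 * Complex.I * μ) :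
    IsLaxColumn (solitonData ρ θ ν) c k (jostU c t ρ θ ν k μ) (jostV c t ρ θ ν k μ) := by
  have htr := re_eq_zero_of_mul_eq hν0 ht
  intro x
  have hw := norm_logisticW_lt ν x
  have hwd := (hasDerivAt_logisticW ν x).ofReal_comp
  have hH := (hasDerivAt_gaussH (t := t) hc htr hw).comp x hwd
  have hG := (hasDerivAt_gaussG (t := t) hc htr hw).comp x hwd
  have hE : HasDerivAt (fun y : ℝ => Complex.exp (Complex.I * (μ * y)))
      (Complex.exp (Complex.I * (μ * x)) * (Complex.I * μ)) x := by
    simpa using ((((hasDerivAt_id x).ofReal_comp).const_mul (μ : ℂ)).const_mul Complex.I).cexp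
  have hGD := gaussG_eq (t := t) hc htr hw
  have hode := one_sub_mul_gaussA (t := t) hc htr hw
  have hp1 := mul_asymEntry (k := k) (μ := μ) hc hρ
  have hp2 := asymEntry_mul_add hc hρ hμ
  have hq := solitonData_eq ρ θ ν x
  have he : Complex.exp (Complex.I * θ) = Complex.exp (Complex.I * (θ / 2)) ^ 2 := by
    rw [← Complex.exp_nat_mul]; congr 1; push_cast; ring
  have he' : conj (Complex.exp (Complex.I * θ)) = Complex.exp (-(Complex.I * (θ / 2))) ^ 2 := by
    rw [← Complex.exp_conj, ← Complex.exp_nat_mul]; congr 1; simp; ring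
  have hq' : conj (solitonData ρ θ ν x) = ρ * (Complex.exp (-(Complex.I * (θ / 2))) ^ 2 +
      logisticW ν x * (1 - Complex.exp (-(Complex.I * (θ / 2))) ^ 2)) := by
    rw [hq]; simp only [map_mul, map_add, map_sub, Complex.conj_ofReal, map_one, he']
  rw [he] at hq
  have hee : Complex.exp (Complex.I * (θ / 2)) * Complex.exp (-(Complex.I * (θ / 2))) = 1 := by
    rw [← Complex.exp_add, add_neg_cancel, Complex.exp_zero]
  -- The only use of the value of `ν`: it ties the logistic rate to the phase jump.
  have hν' : Complex.I * ν =
      ρ * (Complex.exp (Complex.I * (θ / 2)) - Complex.exp (-(Complex.I * (θ / 2)))) := by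
    rw [exp_mul_I_half, exp_neg_mul_I_half, hν]; push_cast; ring
  have hI := Complex.I_sq
  have hJ : c * (Complex.I / c) = Complex.I := by field_simp
  rw [hq', hq]
  refine ⟨?_, ?_⟩
  · convert! hE.mul (((hH.mul_const (Complex.exp (Complex.I * (θ / 2)))).mul_const
      (asymEntry c ρ k μ)).sub (hG.const_mul (Complex.I / c))) using 1
    simp only [jostU, jostV, Function.comp_apply, Pi.sub_apply]
    push_cast
    generalize Complex.exp (Complex.I * (θ / 2)) = e at hee hν' ⊢
    generalize Complex.exp (-(Complex.I * (θ / 2))) = e' at hee hν' ⊢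
    generalize Complex.exp (Complex.I * (μ * x)) = f
    generalize asymEntry c ρ k μ = p at hp1 hp2 ⊢
    generalize gaussH c t (logisticW ν x) = H at hode ⊢
    generalize gaussG c t (logisticW ν x) = G at hGD ⊢
    generalize gaussD c t (logisticW ν x) = D at hode hGD ⊢
    generalize gaussA c t (logisticW ν x) = A at hode ⊢
    generalize (logisticW ν x : ℂ) = w at hode hGD ⊢
    generalize Complex.I / c = J at hJ ⊢
    linear_combination (-f * J * ν * w) * hode - f * J * w * D * ht +
      (2 * Complex.I * μ * f * J - f * ν * (1 - w) * e * p) * hGD - f * H * e * hp2 +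
      f * H * c * ρ * e * (1 - w) * hee + f * H * ν * w * c * hJ + f * H * w * c * hν' +
      J * f * G * hp1 + f * G * (1 - w) * p * ρ * (e ^ 2 - 1) * hJ +
      f * G * (1 - w) * p * (-e * Complex.I * hν' + e * ν * hI + Complex.I * ρ * hee)
  · convert! hE.mul ((hH.mul_const (Complex.exp (-(Complex.I * (θ / 2))))).add
      (hG.const_mul (Complex.I / c * asymEntry c ρ k μ))) using 1
    simp only [jostU, jostV, Function.comp_apply, Pi.add_apply]
    push_cast
    generalize Complex.exp (Complex.I * (θ / 2)) = e at hee hν' ⊢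
    generalize Complex.exp (-(Complex.I * (θ / 2))) = e' at hee hν' ⊢
    generalize Complex.exp (Complex.I * (μ * x)) = f
    generalize asymEntry c ρ k μ = p at hp1 hp2 ⊢
    generalize gaussH c t (logisticW ν x) = H at hode ⊢
    generalize gaussG c t (logisticW ν x) = G at hGD ⊢
    generalize gaussD c t (logisticW ν x) = D at hode hGD ⊢
    generalize gaussA c t (logisticW ν x) = A at hode ⊢
    generalize (logisticW ν x : ℂ) = w at hode hGD ⊢
    generalize Complex.I / c = J at hJ ⊢
    linear_combination (f * J * p * ν * w) * hode + f * J * p * w * D * ht +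
      (-2 * Complex.I * μ * f * J * p - f * ν * (1 - w) * e') * hGD +
      f * H * c * ρ * p * e' * (1 - w) * hee + f * H * e' * hp1 - f * H * p * ν * w * c * hJ -
      f * H * p * w * c * hν' + J * f * G * hp2 + f * G * ρ * (1 - w) * (1 - e' ^ 2) * hJ +
      f * G * (1 - w) * (-e' * Complex.I * hν' + e' * ν * hI - Complex.I * ρ * hee)

/-- `scatBeta θ (-k) μ` is the lower right entry of `P⁻¹ e^{i(θ/2)σ₃} P`, and `scatAlpha` the
off-diagonal one. -/
theorem scatBeta_neg_sub (hc : c ≠ 0) (hρ : ρ ≠ 0) (hμ0 : μ ≠ 0) :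
    scatBeta θ (-k) μ - asymEntry c ρ k μ * scatAlpha c ρ θ μ =
      Complex.exp (-(Complex.I * (θ / 2))) := by
  have hμ0' : (μ : ℂ) ≠ 0 := by exact_mod_cast hμ0
  have hp1 := mul_asymEntry (k := k) (μ := μ) hc hρ
  rw [exp_neg_mul_I_half, scatBeta, scatAlpha]
  field_simp
  linear_combination (-(Real.sin (θ / 2) : ℂ)) * hp1

/-- With `scatBeta_neg_sub`, this says `e^{iθσ₃/2} (p, 1)ᵀ = α (1, -p)ᵀ + β(-k) (p, 1)ᵀ`, the change
from the basis `E₊` to `E₋`. -/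
theorem scatAlpha_add (hc : c ≠ 0) (hρ : ρ ≠ 0) (hμ0 : μ ≠ 0)
    (hμ : (μ : ℂ) ^ 2 = (k : ℂ) ^ 2 - c ^ 2 * (ρ : ℂ) ^ 2) :
    scatAlpha c ρ θ μ + asymEntry c ρ k μ * scatBeta θ (-k) μ =
      asymEntry c ρ k μ * Complex.exp (Complex.I * (θ / 2)) := by
  have hμ0' : (μ : ℂ) ≠ 0 := by exact_mod_cast hμ0
  have hp2 := asymEntry_mul_add hc hρ hμ
  rw [exp_mul_I_half, scatBeta, scatAlpha]
  field_simp
  linear_combination (-(Real.sin (θ / 2) : ℂ)) * hp2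

/-- Since `e^{νx} = (1 - w)/w`, the oscillating factor is `e^{2iμx} = (1 - w)^t w^{-t}`, and `w^{-t}
→ 1`. -/
theorem tendsto_cpow_logistic_mul (hc : c ≠ 0) (hν0 : 0 < ν) (hμ0 : μ ≠ 0)
    (ht : t * ν = 2 * Complex.I * μ) :
    Tendsto (fun x : ℝ => Complex.exp (2 * Complex.I * μ * x) *
      (t * gaussG c t (logisticW ν x) - c ^ 2 * gaussH c t (logisticW ν x))) atBot
      (𝓝 (gaussLimit c t)) := by
  have htr := re_eq_zero_of_mul_eq hν0.ne' ht
  have h1 := (tendsto_cpow_mul_gaussG_sub hc htr (ne_zero_of_mul_eq hμ0 ht)).comp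
    (tendsto_logisticW_atBot hν0)
  have h2 : Tendsto (fun x => ((logisticW ν x : ℝ) : ℂ) ^ (-t)) atBot (𝓝 1) := by
    have h3 : ContinuousAt (fun z : ℂ => z ^ (-t)) 1 :=
      continuousAt_cpow_const (by simp [Complex.slitPlane])
    have h4 : Tendsto (fun x => ((logisticW ν x : ℝ) : ℂ)) atBot (𝓝 1) :=
      (Complex.continuous_ofReal.tendsto' 1 1 (by simp)).comp
        ((tendsto_logisticW_atBot hν0).mono_right nhdsWithin_le_nhds)
    have h5 := h3.tendsto.comp h4
    rwa [Complex.one_cpow] at h5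
  have h6 := h2.mul h1
  rw [one_mul] at h6
  refine h6.congr fun x => ?_
  have hw := logisticW_pos ν x
  have hw0 : (logisticW ν x : ℂ) ≠ 0 := by exact_mod_cast hw.ne'
  simp only [Function.comp_apply]
  rw [← mul_assoc, one_sub_logisticW, Complex.ofReal_mul,
    Complex.mul_cpow_ofReal_nonneg (Real.exp_pos _).le hw.le, Complex.cpow_neg]
  have h7 : ((logisticW ν x : ℝ) : ℂ) ^ t ≠ 0 := fun h => hw0 ((Complex.cpow_eq_zero_iff _ _).1 h).1
  have h8 : ((Real.exp (ν * x) : ℝ) : ℂ) ^ t = Complex.exp (2 * Complex.I * μ * x) := by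
    rw [Complex.ofReal_exp, Complex.cpow_def_of_ne_zero (Complex.exp_ne_zero _),
      ← Complex.ofReal_exp, ← Complex.ofReal_log (Real.exp_pos _).le, Real.log_exp]
    congr 1
    push_cast
    linear_combination x * ht
  rw [h8]
  field_simp

theorem norm_exp_two_I_mul (μ x : ℝ) : ‖Complex.exp (2 * Complex.I * μ * x)‖ = 1 := by
  rw [show 2 * Complex.I * μ * x = ((2 * μ * x : ℝ) : ℂ) * Complex.I by push_cast; ring,
    Complex.norm_exp_ofReal_mul_I]

theorem scatAlpha_eq (hμ0 : μ ≠ 0) (hν : ν = 2 * ρ * Real.sin (θ / 2))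
    (ht : t * ν = 2 * Complex.I * μ) : scatAlpha c ρ θ μ = Complex.I * c / t := by
  have hμ0' : (μ : ℂ) ≠ 0 := by exact_mod_cast hμ0
  have h0 := ne_zero_of_mul_eq hμ0 ht
  rw [hν] at ht
  push_cast at ht
  rw [scatAlpha]
  field_simp
  push_cast
  linear_combination c / 2 * ht

theorem eq_inv_asymE_mul {φ x : ℝ} (hu : IsUnit (asymE c ρ φ k μ x).det)
    {A B : Matrix (Fin 2) (Fin 2) ℂ} (h : asymE c ρ φ k μ x * A = B) :
    A = (asymE c ρ φ k μ x)⁻¹ * B := by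
  rw [← h, ← mul_assoc, Matrix.nonsing_inv_mul _ hu, one_mul]

/-- The limit of the Jost column in the basis `E₋`. -/
theorem tendsto_jost_atBot (hc : c ≠ 0) (hc2 : conj c ^ 2 = c ^ 2) (hρ : ρ ≠ 0) (hν0 : 0 < ν)
    (hμ0 : μ ≠ 0) (hν : ν = 2 * ρ * Real.sin (θ / 2))
    (hμ : (μ : ℂ) ^ 2 = (k : ℂ) ^ 2 - c ^ 2 * (ρ : ℂ) ^ 2) (ht : t * ν = 2 * Complex.I * μ) :
    Tendsto (fun x => (asymE c ρ 0 k μ x)⁻¹ *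
      conjMatrix c (jostU c t ρ θ ν k μ x) (jostV c t ρ θ ν k μ x)) atBot
      (𝓝 (conjMatrix c (-Complex.I / (c * t) * gaussLimit c t)
        (scatBeta θ (-k) μ * ∑' n, gaussCoeff c (1 - t) n))) := by
  have htr := re_eq_zero_of_mul_eq hν0.ne' ht
  have h0 := ne_zero_of_mul_eq hμ0 ht
  have h1 := (tendsto_cpow_logistic_mul hc hν0 hμ0 ht).const_mul (-Complex.I / (c * t))
  have h2 := ((tendsto_gaussH hc htr).comp (tendsto_logisticW_atBot hν0)).const_mul
    (scatBeta θ (-k) μ)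
  refine (((continuous_conjMatrix c).tendsto (_, _)).comp (h1.prodMk_nhds h2)).congr fun x => ?_
  have hu := asymE_isUnit_det hc hρ hμ0 hμ 0 x
  have hb := scatBeta_neg_sub (θ := θ) (k := k) hc hρ hμ0
  have ha := scatAlpha_add (θ := θ) hc hρ hμ0 hμ
  rw [scatAlpha_eq hμ0 hν ht] at ha hb
  have he : Complex.exp (2 * Complex.I * μ * x) * Complex.exp (-(Complex.I * (μ * x))) =
      Complex.exp (Complex.I * (μ * x)) := by
    rw [← Complex.exp_add]; congr 1; ring
  refine eq_inv_asymE_mul hu ?_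
  simp only [Function.comp_apply]
  rw [asymE_mul_conjMatrix hc hc2, asymE_eq, jostU, jostV]
  simp only [Matrix.of_apply, Matrix.cons_val', Matrix.cons_val_zero, Matrix.cons_val_one,
    Matrix.cons_val_fin_one, Complex.ofReal_zero, zero_div, mul_zero, neg_zero, Complex.exp_zero,
    mul_one, one_mul]
  -- The first coordinate is `e^{2iμx} (αH - (i/c)G)`; because `α = ic/t`, this is the one
  -- combination known to converge.
  have e1 : -Complex.I / (c * t) * (Complex.exp (2 * Complex.I * μ * x) *
      (t * gaussG c t (logisticW ν x) - c ^ 2 * gaussH c t (logisticW ν x))) =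
      Complex.exp (2 * Complex.I * μ * x) * (Complex.I * c / t * gaussH c t (logisticW ν x) -
        Complex.I / c * gaussG c t (logisticW ν x)) := by
    field_simp
    ring
  rw [e1]
  congr 1
  · linear_combination (Complex.I * c / t * gaussH c t (logisticW ν x) -
        Complex.I / c * gaussG c t (logisticW ν x)) * he +
      Complex.exp (Complex.I * (μ * x)) * gaussH c t (logisticW ν x) * ha
  · linear_combination (-asymEntry c ρ k μ) * (Complex.I * c / t * gaussH c t (logisticW ν x) -
        Complex.I / c * gaussG c t (logisticW ν x)) * he +
      Complex.exp (Complex.I * (μ * x)) * gaussH c t (logisticW ν x) * hb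

/-- The limit of the Jost column in the basis `E₊`. -/
theorem tendsto_jost_atTop (hc : c ≠ 0) (hc2 : conj c ^ 2 = c ^ 2) (hρ : ρ ≠ 0) (hν0 : 0 < ν)
    (hμ0 : μ ≠ 0) (hμ : (μ : ℂ) ^ 2 = (k : ℂ) ^ 2 - c ^ 2 * (ρ : ℂ) ^ 2)
    (ht : t * ν = 2 * Complex.I * μ) :
    Tendsto (fun x => (asymE c ρ θ k μ x)⁻¹ *
      conjMatrix c (jostU c t ρ θ ν k μ x) (jostV c t ρ θ ν k μ x)) atTop (𝓝 1) := by
  have htr := re_eq_zero_of_mul_eq hν0.ne' ht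
  have hw : Tendsto (fun x => ((logisticW ν x : ℝ) : ℂ)) atTop (𝓝 0) :=
    (Complex.continuous_ofReal.tendsto' 0 0 (by simp)).comp (tendsto_logisticW_atTop hν0)
  have hH := (hasDerivAt_gaussH (t := t) hc htr (z := 0) (by simp)).continuousAt.tendsto.comp hw
  have hG := (hasDerivAt_gaussG (t := t) hc htr (z := 0) (by simp)).continuousAt.tendsto.comp hw
  rw [gaussH_zero hc htr] at hH
  rw [gaussG_zero hc htr] at hG
  -- In the basis `E₊` the first coordinate is `G → 0` times a bounded oscillation, the second is `H
  -- + (i/c) α G`.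
  have h1 : Tendsto (fun x : ℝ => Complex.exp (2 * Complex.I * μ * x) *
      (-(Complex.I / c * scatBeta θ (-k) μ) * gaussG c t (logisticW ν x))) atTop (𝓝 0) := by
    have h := hG.const_mul (-(Complex.I / c * scatBeta θ (-k) μ))
    rw [mul_zero, tendsto_zero_iff_norm_tendsto_zero] at h
    rw [tendsto_zero_iff_norm_tendsto_zero]
    refine h.congr fun x => ?_
    rw [norm_mul (Complex.exp _), norm_exp_two_I_mul, one_mul]
    rfl
  have h2 := hH.add (hG.const_mul (Complex.I / c * scatAlpha c ρ θ μ))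
  rw [mul_zero, add_zero] at h2
  have h3 : conjMatrix c 0 1 = 1 := by
    simp [conjMatrix, Matrix.one_fin_two]
  rw [← h3]
  refine (((continuous_conjMatrix c).tendsto (_, _)).comp (h1.prodMk_nhds h2)).congr fun x => ?_
  have hu := asymE_isUnit_det hc hρ hμ0 hμ θ x
  have hb := scatBeta_neg_sub (θ := θ) (k := k) hc hρ hμ0
  have ha := scatAlpha_add (θ := θ) hc hρ hμ0 hμ
  have he : Complex.exp (2 * Complex.I * μ * x) * Complex.exp (-(Complex.I * (μ * x))) =
      Complex.exp (Complex.I * (μ * x)) := by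
    rw [← Complex.exp_add]; congr 1; ring
  have hee : Complex.exp (Complex.I * (θ / 2)) * Complex.exp (-(Complex.I * (θ / 2))) = 1 := by
    rw [← Complex.exp_add, add_neg_cancel, Complex.exp_zero]
  refine eq_inv_asymE_mul hu ?_
  simp only [Function.comp_apply]
  rw [asymE_mul_conjMatrix hc hc2, asymE_eq, jostU, jostV]
  simp only [Matrix.of_apply, Matrix.cons_val', Matrix.cons_val_zero, Matrix.cons_val_one,
    Matrix.cons_val_fin_one]
  generalize Complex.exp (Complex.I * (θ / 2)) = e at *
  generalize Complex.exp (-(Complex.I * (θ / 2))) = e' at *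
  generalize Complex.exp (Complex.I * (μ * x)) = f at *
  generalize Complex.exp (-(Complex.I * (μ * x))) = f' at *
  generalize Complex.exp (2 * Complex.I * μ * x) = g at *
  generalize gaussG c t (logisticW ν x) = G
  generalize gaussH c t (logisticW ν x) = H
  generalize asymEntry c ρ k μ = p at *
  congr 1
  · linear_combination (-e * (Complex.I / c * scatBeta θ (-k) μ) * G) * he -
      Complex.I / c * G * e * f * hb - Complex.I / c * G * f * hee
  · linear_combination (p * e' * (Complex.I / c * scatBeta θ (-k) μ) * G) * he +
      Complex.I / c * G * e' * f * ha + p * Complex.I / c * G * f * hee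

end

/-! ### The scattering data -/

section
variable {c t : ℂ} {ρ θ ν k μ : ℝ}

theorem Gamma_ne_zero_of_im_ne_zero {s : ℂ} (hs : s.im ≠ 0) : Complex.Gamma s ≠ 0 :=
  Complex.Gamma_ne_zero fun m h => hs (by simp [h])

theorem Gamma_one_sub_add_ne_zero (ht : t.re = 0) (ht0 : t ≠ 0) (hc : c.im = 0 ∨ c.re = 0) :
    Complex.Gamma (1 - t + c) ≠ 0 := by
  rcases hc with hc | hc
  · refine Gamma_ne_zero_of_im_ne_zero ?_
    have : t.im ≠ 0 := fun h => ht0 (Complex.ext ht h)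
    simpa [hc] using this
  · exact Complex.Gamma_ne_zero_of_re_pos (by simp [ht, hc])

theorem tsum_gaussCoeff_one_sub (hc0 : c ≠ 0) (ht : t.re = 0) (ht0 : t ≠ 0)
    (hc : c.im = 0 ∨ c.re = 0) : ∑' n, gaussCoeff c (1 - t) n =
      Complex.Gamma (1 - t) ^ 2 / (Complex.Gamma (1 - t - c) * Complex.Gamma (1 - t + c)) := by
  refine tsum_gaussCoeff hc0 (by simp [ht]) ?_ (Gamma_one_sub_add_ne_zero ht ht0 hc)
  rw [sub_eq_add_neg (1 - t) c]
  exact Gamma_one_sub_add_ne_zero ht ht0 (by simpa using hc)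

/-- The dispersion relation gives `β(k) β(-k) = 1 + α²`, and `α = ic/t`. -/
theorem scatBeta_mul_neg (hμ0 : μ ≠ 0) (hν : ν = 2 * ρ * Real.sin (θ / 2))
    (hμ : (μ : ℂ) ^ 2 = (k : ℂ) ^ 2 - c ^ 2 * (ρ : ℂ) ^ 2) (ht : t * ν = 2 * Complex.I * μ) :
    scatBeta θ k μ * scatBeta θ (-k) μ = (t - c) * (t + c) / t ^ 2 := by
  have hμ0' : (μ : ℂ) ≠ 0 := by exact_mod_cast hμ0
  have h0 := ne_zero_of_mul_eq hμ0 ht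
  have ha := scatAlpha_eq (c := c) hμ0 hν ht
  have h1 : scatBeta θ k μ * scatBeta θ (-k) μ = 1 + scatAlpha c ρ θ μ ^ 2 := by
    have hs : (Real.cos (θ / 2) : ℂ) ^ 2 + (Real.sin (θ / 2) : ℂ) ^ 2 = 1 := by
      exact_mod_cast Real.cos_sq_add_sin_sq (θ / 2)
    simp only [scatBeta, scatAlpha]
    field_simp
    linear_combination μ ^ 2 * hs - (Real.sin (θ / 2) : ℂ) ^ 2 * hμ -
      (Real.sin (θ / 2) : ℂ) ^ 2 * k ^ 2 * Complex.I_sq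
  rw [h1, ha]
  field_simp
  linear_combination c ^ 2 * Complex.I_sq

theorem scatBeta_neg_eq_conj : scatBeta θ (-k) μ = conj (scatBeta θ k μ) := by
  simp only [scatBeta, map_add, map_mul, map_div₀, Complex.conj_I, Complex.conj_ofReal]
  ring

theorem neg_I_div_mul_gaussLimit (hc : c ≠ 0) (hν0 : ν ≠ 0) (hμ0 : μ ≠ 0)
    (hν : ν = 2 * ρ * Real.sin (θ / 2)) (ht : t * ν = 2 * Complex.I * μ) :
    -Complex.I / (c * t) * gaussLimit c t =
      scatAlpha c ρ θ μ * (Complex.sin (Real.pi * c) / (Real.pi * c)) *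
        (Complex.sinh (2 * Real.pi * μ / ν) / (2 * Real.pi * μ / ν))⁻¹ := by
  have h0 := ne_zero_of_mul_eq hμ0 ht
  have hν0' : (ν : ℂ) ≠ 0 := by exact_mod_cast hν0
  have h1 : (Real.pi : ℂ) * t = 2 * Real.pi * μ / ν * Complex.I := by
    field_simp
    linear_combination ht
  rw [scatAlpha_eq hμ0 hν ht, gaussLimit, h1, Complex.sin_mul_I, mul_div_mul_right _ _ Complex.I_ne_zero]
  generalize (Complex.sinh (2 * Real.pi * μ / ν) / (2 * Real.pi * μ / ν))⁻¹ = X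
  generalize Complex.sin (Real.pi * c) / (Real.pi * c) = Y
  field_simp

/-- By `Γ(s + 1) = sΓ(s)`, passing from `n` to `n + 1` multiplies the left side by `(t + n + 1)/(t -
n)`. No factor vanishes since `t` is not real. -/
theorem Gamma_quotient_eq_prod (ht : t.re = 0) (ht0 : t ≠ 0) (n : ℕ) :
    (t - n) * (t + n) / t ^ 2 * (Complex.Gamma (1 - t) ^ 2 /
      (Complex.Gamma (1 - t - n) * Complex.Gamma (1 - t + n))) =
      ∏ m ∈ Finset.Icc 1 n, (t + m) / (t - ((m : ℂ) - 1)) := by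
  have him : t.im ≠ 0 := fun h => ht0 (Complex.ext ht h)
  have hne : ∀ s : ℂ, s.im = 0 → t + s ≠ 0 := fun s hs h => him (by
    have := congrArg Complex.im h
    simpa [hs] using this)
  induction n with
  | zero =>
    have : Complex.Gamma (1 - t) ≠ 0 := Gamma_ne_zero_of_im_ne_zero (by simpa using him)
    simp
    field_simp
  | succ n ih =>
    rw [Finset.prod_Icc_succ_top (by omega), ← ih]
    have h1 : t + n ≠ 0 := hne _ (by simp)
    have h2 : t - n ≠ 0 := by rw [sub_eq_add_neg]; exact hne _ (by simp)
    have h3 : t - n - 1 ≠ 0 := by rw [sub_sub, sub_eq_add_neg]; exact hne _ (by simp)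
    have g1 : Complex.Gamma (1 - t - n) = (-(t + n)) * Complex.Gamma (-(t + n)) := by
      rw [← Complex.Gamma_add_one _ (neg_ne_zero.2 h1)]; congr 1; ring
    have g2 : Complex.Gamma (1 - t + (n + 1)) = (-(t - n - 1)) * Complex.Gamma (1 - t + n) := by
      have h4 : 1 - t + n ≠ 0 := by
        have := neg_ne_zero.2 h3
        rwa [show -(t - n - 1) = 1 - t + n by ring] at this
      rw [← add_assoc, Complex.Gamma_add_one _ h4]; congr 1; ring
    have g3 : Complex.Gamma (1 - t - (n + 1)) = Complex.Gamma (-(t + n)) := by congr 1; ring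
    have k1 : Complex.Gamma (-(t + n)) ≠ 0 := Gamma_ne_zero_of_im_ne_zero (by simpa using him)
    have k2 : Complex.Gamma (1 - t + n) ≠ 0 := Gamma_ne_zero_of_im_ne_zero (by simpa using him)
    push_cast
    rw [g1, g2, g3, show t - (n + 1 - 1) = t - (n : ℂ) by ring]
    field_simp
    ring

theorem prod_eq_multisoliton_prod (hν0 : ν ≠ 0) (ht : t * ν = 2 * Complex.I * μ) (n : ℕ) :
    ∏ m ∈ Finset.Icc 1 n, (t + m) / (t - ((m : ℂ) - 1)) =
      ∏ m ∈ Finset.Icc 1 n, (2 * (μ : ℂ) - Complex.I * m * ν) /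
        (2 * μ + Complex.I * ((m : ℂ) - 1) * ν) := by
  have hν0' : (ν : ℂ) ≠ 0 := by exact_mod_cast hν0
  have h : 2 * (μ : ℂ) = -Complex.I * (t * ν) := by
    linear_combination Complex.I * ht + 2 * μ * Complex.I_sq
  refine Finset.prod_congr rfl fun m _ => ?_
  rw [h, ← mul_div_mul_left (t + m) _ (mul_ne_zero (neg_ne_zero.2 Complex.I_ne_zero) hν0')]
  congr 1 <;> ring

/-- The scattering data of the soliton potential. -/
theorem soliton_scattering (hc0 : c ≠ 0) (hc : c.im = 0 ∨ c.re = 0) (hρ : ρ ≠ 0) (hν0 : 0 < ν)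
    (hμ0 : μ ≠ 0) (hν : ν = 2 * ρ * Real.sin (θ / 2))
    (hμ : (μ : ℂ) ^ 2 = (k : ℂ) ^ 2 - c ^ 2 * (ρ : ℂ) ^ 2) (ht : t * ν = 2 * Complex.I * μ) :
    (∃! Ψp, IsJost atTop (solitonData ρ θ ν) c ρ θ k μ Ψp) ∧
    (∃! Ψm, IsJost atBot (solitonData ρ θ ν) c ρ 0 k μ Ψm) ∧
    ∃ a b : ℂ,
      (∀ S, IsScatteringMatrix (solitonData ρ θ ν) c ρ 0 θ k μ S ↔ S = conjMatrix c b a) ∧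
      (∀ Ψp, IsJost atTop (solitonData ρ θ ν) c ρ θ k μ Ψp →
        Tendsto (fun x => (asymE c ρ 0 k μ x)⁻¹ * Ψp x) atBot (𝓝 (conjMatrix c b a))) ∧
      a = scatBeta θ (-k) μ * (Complex.Gamma (1 - t) ^ 2 /
        (Complex.Gamma (1 - t - c) * Complex.Gamma (1 - t + c))) ∧
      b = scatAlpha c ρ θ μ * (Complex.sin (Real.pi * c) / (Real.pi * c)) *
        (Complex.sinh (2 * Real.pi * μ / ν) / (2 * Real.pi * μ / ν))⁻¹ := by
  have hc2 : conj c ^ 2 = c ^ 2 := by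
    rcases hc with h | h
    · rw [Complex.conj_eq_iff_im.2 h]
    · rw [conj_eq_neg_of_re_eq_zero h, neg_sq]
  have hJ : IsJost atTop (solitonData ρ θ ν) c ρ θ k μ fun x =>
      conjMatrix c (jostU c t ρ θ ν k μ x) (jostV c t ρ θ ν k μ x) :=
    isJost_iff.2 ⟨(isLaxColumn_jost hc0 hρ hν0.ne' hν hμ ht).isLaxSolution hc0 hc2,
      tendsto_jost_atTop hc0 hc2 hρ hν0 hμ0 hμ ht⟩
  have hS := tendsto_jost_atBot hc0 hc2 hρ hν0 hμ0 hν hμ ht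
  obtain ⟨h1, h2, h3, h4⟩ := scattering_of_tendsto hc0 hρ hμ0 hμ hJ hS
  refine ⟨h1, h2, _, _, h3, h4, ?_, neg_I_div_mul_gaussLimit hc0 hν0.ne' hμ0 hν ht⟩
  rw [tsum_gaussCoeff_one_sub hc0 (re_eq_zero_of_mul_eq hν0.ne' ht) (ne_zero_of_mul_eq hμ0 ht) hc]

end

/-! ### Zeros of the multisoliton coefficient -/

theorem multisolitonA_eq_zero_iff {ν θ : ℝ} (hν0 : 0 < ν) (n : ℕ) {k μ : ℂ} (hμ : 0 < μ.im)
    (hβ : scatBeta θ k μ ≠ 0) : multisolitonA n θ ν k μ = 0 ↔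
      ∃ m ∈ Finset.Icc 1 n, μ = Complex.I * m * ν / 2 := by
  rw [multisolitonA, mul_eq_zero, or_iff_right (one_div_ne_zero hβ), Finset.prod_eq_zero_iff]
  refine exists_congr fun m => and_congr_right fun hm => ?_
  have hm1 : (1 : ℝ) ≤ m := by exact_mod_cast (Finset.mem_Icc.1 hm).1
  -- The imaginary part is `2 Im μ + (m - 1)ν > 0`.
  have hden : 2 * μ + Complex.I * ((m : ℂ) - 1) * ν ≠ 0 := fun h => by
    have h1 := congrArg Complex.im h
    simp at h1
    nlinarith [mul_nonneg (sub_nonneg.2 hm1) hν0.le]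
  rw [div_eq_zero_iff, or_iff_left hden, sub_eq_zero, eq_div_iff two_ne_zero, mul_comm μ]

/-- Here `k² = n²ρ² - m²ν²/4`, which is nonnegative because `ν ≤ 2ρ` and `m ≤ n`, and smaller than
`n²ρ²` because `mν > 0`. -/
theorem real_of_multisoliton_zero {ρ θ ν : ℝ} (hρ : 0 < ρ) (hν0 : 0 < ν)
    (hν : ν = 2 * ρ * Real.sin (θ / 2)) {n m : ℕ} (hm : m ∈ Finset.Icc 1 n) {k μ : ℂ}
    (hμ : μ ^ 2 = k ^ 2 - (n : ℂ) ^ 2 * (ρ : ℂ) ^ 2) (h : μ = Complex.I * m * ν / 2) :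
    k.im = 0 ∧ |k.re| < n * ρ := by
  obtain ⟨hm1, hmn⟩ := Finset.mem_Icc.1 hm
  have hm1' : (1 : ℝ) ≤ m := by exact_mod_cast hm1
  have hmn' : (m : ℝ) ≤ n := by exact_mod_cast hmn
  have hνρ : ν ≤ 2 * ρ := by rw [hν]; nlinarith [Real.sin_le_one (θ / 2)]
  have hk : k ^ 2 = ((n ^ 2 * ρ ^ 2 - m ^ 2 * ν ^ 2 / 4 : ℝ) : ℂ) := by
    rw [h] at hμ
    push_cast
    linear_combination -hμ + (m : ℂ) ^ 2 * ν ^ 2 / 4 * Complex.I_sq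
  have hre := congrArg Complex.re hk
  have him := congrArg Complex.im hk
  rw [sq, Complex.mul_re, Complex.ofReal_re] at hre
  rw [sq, Complex.mul_im, Complex.ofReal_im] at him
  have hpos : 0 ≤ (n : ℝ) ^ 2 * ρ ^ 2 - m ^ 2 * ν ^ 2 / 4 := by
    have h1 : m * ν ≤ n * (2 * ρ) := mul_le_mul hmn' hνρ hν0.le (by positivity)
    have h2 : (m * ν) ^ 2 ≤ (n * (2 * ρ)) ^ 2 := pow_le_pow_left₀ (by positivity) h1 2
    linarith
  have him0 : k.im = 0 := by
    by_contra h0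
    have : k.re = 0 := by
      have : k.re * k.im = 0 := by linarith
      exact (mul_eq_zero.1 this).resolve_right h0
    rw [this] at hre
    have : 0 < k.im * k.im := mul_self_pos.2 h0
    linarith
  refine ⟨him0, abs_lt_of_sq_lt_sq ?_ (by positivity)⟩
  rw [him0] at hre
  have : 0 < (m : ℝ) ^ 2 * ν ^ 2 := by positivity
  nlinarith

/-! ### The finite density class -/

/-- Differentiation along `u' = κu(1 - u)` preserves the form `u p(u)`, so all derivatives decay as
fast as `u`. -/
theorem iteratedDeriv_logistic {κ : ℝ} {u : ℝ → ℝ}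
    (hu : ∀ x, HasDerivAt u (κ * u x * (1 - u x)) x) (A : ℂ) (n : ℕ) :
    ∃ p : Polynomial ℝ, iteratedDeriv n (fun y => A * (u y : ℂ)) =
      fun x => A * ((u x * p.eval (u x) : ℝ) : ℂ) := by
  induction n with
  | zero => exact ⟨1, by simp⟩
  | succ n ih =>
    obtain ⟨p, hp⟩ := ih
    refine ⟨Polynomial.C κ * (1 - Polynomial.X) * (p + Polynomial.X * Polynomial.derivative p), ?_⟩
    rw [iteratedDeriv_succ, hp]
    funext x
    have h : HasDerivAt (fun x => u x * p.eval (u x)) _ x :=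
      (hu x).mul ((p.hasDerivAt (u x)).comp x (hu x))
    rw [(h.ofReal_comp.const_mul A).deriv]
    refine congrArg (fun r : ℝ => A * (r : ℂ)) ?_
    simp
    ring

theorem tendsto_pow_mul_iteratedDeriv_logistic {κ : ℝ} {u : ℝ → ℝ} {l : Filter ℝ}
    (hu : ∀ x, HasDerivAt u (κ * u x * (1 - u x)) x) (hb : ∀ x, u x ∈ Set.Icc (0 : ℝ) 1)
    (m n : ℕ) (hl : Tendsto (fun x => x ^ m * u x) l (𝓝 0)) (A : ℂ) :
    Tendsto (fun x : ℝ => (x : ℂ) ^ m * iteratedDeriv n (fun y : ℝ => A * (u y : ℂ)) x) l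
      (𝓝 0) := by
  obtain ⟨p, hp⟩ := iteratedDeriv_logistic hu A n
  obtain ⟨M, hM⟩ := (isCompact_Icc (a := (0 : ℝ)) (b := 1)).exists_bound_of_continuousOn
    p.continuous.continuousOn
  have h := (hl.norm.const_mul ‖A‖).mul_const M
  rw [norm_zero, mul_zero, zero_mul] at h
  refine squeeze_zero_norm (fun x => ?_) h
  have e : (x : ℂ) ^ m * (A * ((u x * p.eval (u x) : ℝ) : ℂ)) =
      A * ((x ^ m * u x : ℝ) : ℂ) * ((p.eval (u x) : ℝ) : ℂ) := by push_cast; ring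
  rw [hp, e, norm_mul, norm_mul, Complex.norm_real, Complex.norm_real]
  gcongr
  exact hM _ (hb x)

theorem tendsto_pow_mul_logisticW {ν : ℝ} (hν : 0 < ν) (m : ℕ) :
    Tendsto (fun x => x ^ m * logisticW ν x) atTop (𝓝 0) := by
  have h := ((Real.tendsto_pow_mul_exp_neg_atTop_nhds_zero m).comp
    (tendsto_id.const_mul_atTop hν)).const_mul ((ν ^ m)⁻¹)
  rw [mul_zero] at h
  refine squeeze_zero' ?_ ?_ h
  · filter_upwards [eventually_ge_atTop 0] with x hx
    exact mul_nonneg (pow_nonneg hx m) (logisticW_pos ν x).le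
  · filter_upwards [eventually_ge_atTop 0] with x hx
    have h1 : (ν ^ m)⁻¹ * ((ν * x) ^ m * Real.exp (-(ν * x))) = x ^ m * Real.exp (-(ν * x)) := by
      rw [mul_pow]; field_simp
    simp only [Function.comp_apply, id]
    rw [h1, Real.exp_neg, logisticW]
    have h2 := Real.exp_pos (ν * x)
    gcongr
    linarith

theorem one_sub_logisticW_eq (ν x : ℝ) : 1 - logisticW ν x = logisticW ν (-x) := by
  have : 0 < Real.exp (ν * x) := Real.exp_pos _
  rw [logisticW, logisticW, mul_neg, Real.exp_neg]
  field_simp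
  ring

theorem isFiniteDensity_solitonData (ρ θ : ℝ) {ν : ℝ} (hν : 0 < ν) :
    IsFiniteDensity ρ 0 θ (solitonData ρ θ ν) := by
  have hb : ∀ x, logisticW ν x ∈ Set.Icc (0 : ℝ) 1 := fun x =>
    ⟨(logisticW_pos ν x).le, by linarith [one_sub_logisticW_pos ν x]⟩
  refine ⟨?_, fun m n => ⟨?_, ?_⟩⟩
  · have h1 : ContDiff ℝ ((⊤ : ℕ∞) : WithTop ℕ∞) (logisticW ν) := by
      refine ContDiff.inv (by fun_prop) fun x => ?_
      positivity
    rw [funext (solitonData_eq ρ θ ν)]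
    exact contDiff_const.mul (contDiff_const.add
      ((Complex.ofRealCLM.contDiff.comp h1).mul contDiff_const))
  · have e : (fun y : ℝ => solitonData ρ θ ν y - ρ * Complex.exp (Complex.I * (0 : ℝ))) =
        fun y => ρ * (Complex.exp (Complex.I * θ) - 1) * ((1 - logisticW ν y : ℝ) : ℂ) := by
      funext y
      rw [solitonData_eq]
      simp
      ring
    rw [e]
    refine tendsto_pow_mul_iteratedDeriv_logistic (κ := ν) (fun x => ?_) (fun x => ?_) m n ?_ _
    · convert! (hasDerivAt_logisticW ν x).const_sub 1 using 1
      ring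
    · rw [one_sub_logisticW_eq]
      exact hb _
    · have h := ((tendsto_pow_mul_logisticW hν m).comp tendsto_neg_atBot_atTop).const_mul
        ((-1 : ℝ) ^ m)
      rw [mul_zero] at h
      refine h.congr fun x => ?_
      simp only [Function.comp_apply]
      rw [one_sub_logisticW_eq, ← mul_assoc, ← mul_pow, neg_one_mul, neg_neg]
  · have e : (fun y : ℝ => solitonData ρ θ ν y - ρ * Complex.exp (Complex.I * θ)) =
        fun y => ρ * (1 - Complex.exp (Complex.I * θ)) * (logisticW ν y : ℂ) := by
      funext y
      rw [solitonData_eq]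
      ring
    rw [e]
    refine tendsto_pow_mul_iteratedDeriv_logistic (κ := -ν) (fun x => ?_) hb m n
      (tendsto_pow_mul_logisticW hν m) _
    convert hasDerivAt_logisticW ν x using 1
    ring

end

/-! ### Assembly of the theorem -/

theorem mainTheorem4 (ρ θ ν : ℝ) (hρ : 0 < ρ) (hθ₀ : 0 < θ) (hθ₁ : θ < 2 * Real.pi)
    (hν : ν = 2 * ρ * Real.sin (θ / 2)) :
    IsFiniteDensity ρ 0 θ (solitonData ρ θ ν) ∧
    (∀ c : ℂ, (∃ g : ℝ, 0 < g ∧ (c = g ∨ c = Complex.I * g)) →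
      ∀ k μ : ℝ, μ ≠ 0 → (μ : ℂ) ^ 2 = (k : ℂ) ^ 2 - c ^ 2 * (ρ : ℂ) ^ 2 →
        (∃! Ψp, IsJost atTop (solitonData ρ θ ν) c ρ θ k μ Ψp) ∧
        (∃! Ψm, IsJost atBot (solitonData ρ θ ν) c ρ 0 k μ Ψm) ∧
        ∃ a b : ℂ,
          (∀ S, IsScatteringMatrix (solitonData ρ θ ν) c ρ 0 θ k μ S ↔
            S = !![conj a, b; conj c / c * conj b, a]) ∧
          (∀ Ψp, IsJost atTop (solitonData ρ θ ν) c ρ θ k μ Ψp →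
            Tendsto (fun x => (asymE c ρ 0 k μ x)⁻¹ * Ψp x) atBot
              (𝓝 !![conj a, b; conj c / c * conj b, a])) ∧
          (scatBeta θ k μ ≠ 0 →
            a = (2 * Complex.I * μ / ν - c) * (2 * Complex.I * μ / ν + c) /
                  (scatBeta θ k μ * (2 * Complex.I * μ / ν) ^ 2) *
                (Complex.Gamma (1 - 2 * Complex.I * μ / ν) ^ 2 /
                  (Complex.Gamma (1 - 2 * Complex.I * μ / ν - c) *
                    Complex.Gamma (1 - 2 * Complex.I * μ / ν + c)))) ∧
          (scatBeta θ k μ = 0 → a = 0) ∧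
          b = scatAlpha c ρ θ μ * (Complex.sin (Real.pi * c) / (Real.pi * c)) *
                (Complex.sinh (2 * Real.pi * μ / ν) / (2 * Real.pi * μ / ν))⁻¹ ∧
          (∀ n : ℕ, c = n → scatBeta θ k μ ≠ 0 ∧ b = 0 ∧ a = multisolitonA n θ ν k μ)) ∧
    (∀ n : ℕ, 1 ≤ n → ∀ k μ : ℂ, μ ^ 2 = k ^ 2 - (n : ℂ) ^ 2 * (ρ : ℂ) ^ 2 → 0 < μ.im →
      scatBeta θ k μ ≠ 0 →
        (multisolitonA n θ ν k μ = 0 ↔ ∃ m ∈ Finset.Icc 1 n, μ = Complex.I * m * ν / 2) ∧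
        (multisolitonA n θ ν k μ = 0 → k.im = 0 ∧ |k.re| < n * ρ)) := by
  have hs : 0 < Real.sin (θ / 2) := Real.sin_pos_of_pos_of_lt_pi (by linarith) (by linarith)
  have hν0 : 0 < ν := by rw [hν]; positivity
  have hν0' : (ν : ℂ) ≠ 0 := by exact_mod_cast hν0.ne'
  refine ⟨isFiniteDensity_solitonData ρ θ hν0, ?_, ?_⟩
  · rintro c ⟨g, hg, hcg⟩ k μ hμ0 hμ
    have hc0 : c ≠ 0 := by
      rcases hcg with rfl | rfl <;> simp [hg.ne']
    have hc : c.im = 0 ∨ c.re = 0 := by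
      rcases hcg with rfl | rfl <;> simp
    have ht : 2 * Complex.I * μ / ν * ν = 2 * Complex.I * (μ : ℂ) := by field_simp
    have htr := re_eq_zero_of_mul_eq hν0.ne' ht
    have ht0 := ne_zero_of_mul_eq hμ0 ht
    obtain ⟨h1, h2, a, b, h3, h4, ha, hb⟩ :=
      soliton_scattering hc0 hc hρ.ne' hν0 hμ0 hν hμ ht
    have hββ := scatBeta_mul_neg hμ0 hν hμ ht
    have ha' : scatBeta θ k μ ≠ 0 →
        a = (2 * Complex.I * μ / ν - c) * (2 * Complex.I * μ / ν + c) /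
            (scatBeta θ k μ * (2 * Complex.I * μ / ν) ^ 2) *
          (Complex.Gamma (1 - 2 * Complex.I * μ / ν) ^ 2 /
            (Complex.Gamma (1 - 2 * Complex.I * μ / ν - c) *
              Complex.Gamma (1 - 2 * Complex.I * μ / ν + c))) := fun hβ => by
      rw [ha]
      congr 1
      rw [mul_comm (scatBeta θ k μ), ← div_div, ← hββ, mul_div_cancel_left₀ _ hβ]
    refine ⟨h1, h2, a, b, h3, h4, ha', fun hβ => ?_, hb, ?_⟩
    · rw [ha, scatBeta_neg_eq_conj, hβ, map_zero, zero_mul]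
    · rintro n rfl
      have him : (2 * Complex.I * μ / ν : ℂ).im ≠ 0 := fun h => ht0 (Complex.ext htr h)
      -- If `β = 0` then `t = n` or `t = -n`, but `t` is not real.
      have hβ : scatBeta θ k μ ≠ 0 := fun h => by
        rw [h, zero_mul] at hββ
        refine div_ne_zero (mul_ne_zero ?_ ?_) (pow_ne_zero 2 ht0) hββ.symm <;>
          intro h' <;> refine him ?_ <;> simpa using congrArg Complex.im h'
      refine ⟨hβ, ?_, ?_⟩
      · rw [hb, mul_comm (Real.pi : ℂ), Complex.sin_nat_mul_pi]
        simp
      · rw [ha' hβ, mul_comm (scatBeta θ k μ), ← div_div, div_mul_eq_mul_div,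
          Gamma_quotient_eq_prod htr ht0, prod_eq_multisoliton_prod hν0.ne' ht, multisolitonA,
          div_mul_eq_mul_div, one_mul]
  · intro n _ k μ hμ him hβ
    refine ⟨multisolitonA_eq_zero_iff hν0 n him hβ, fun h => ?_⟩
    obtain ⟨m, hm, h'⟩ := (multisolitonA_eq_zero_iff hν0 n him hβ).1 h
    exact real_of_multisoliton_zero hρ hν0 hν hm hμ h'
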